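/- **Conventions.** A filtered space of formal dimension $n$ is a non-empty space $X$ with closed subsets $\emptyset=X_{-1}\subseteq X_0\subseteq\dots\subseteq X_{n-1}\subsetneq X_n=X$. Its strata of dimension $i$ (codimension $n-i$) are the connected components of $X^i=X_i\setminus X_{i-1}$; they are regular if $i=n$ and singular otherwise, and a point is regular if it lies in $X\setminus X_{n-1}$. Open subsets carry the induced filtration, products $Y\times X$ the filtration $(Y\times X)_i=Y\times X_i$, and, for $L$ compact, the open cone $\mathring{c}L=L\times[0,1[\,/\,L\times\{0\}$ of apex $\mathtt v$ carries the filtration $(\mathring{c}L)_i=\mathring{c}(L_{i-1})$, $i\ge 0$, where $\mathring{c}\emptyset=\{\mathtt v\}$. A stratified map is a continuous map that sends each stratum into a stratum of at most the same codimension; a stratified homeomorphism is a homeomorphism that is stratified together with its inverse. A CS set of dimension $n$ is a filtered space $X$ of formal dimension $n$ such that each $X^i$ is a topological manifold of dimension $i$ (possibly empty; its components, the strata, are thus $i$-manifolds), and such that each point $x\in X^i$, $i\ne n$, has an open neighborhood $V$ in $X$, an open neighborhood $U$ in $X^i$, a compact Hausdorff filtered space $L$ of formal dimension $n-i-1$ (a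 link of $x$), and a stratified homeomorphism $\varphi\colon U\times\mathring{c}L\to V$ with $\varphi(U\times\mathring{c}L_j)=V\cap X_{i+j+1}$ for $0\le j\le n-i-1$ and $\varphi(u,\mathtt v)=u$ for $u\in U$. It is normal if all its links are connected. A perversity $\overline p$ on $X$ is a map from the set of strata to $\mathbb Z\cup\{\pm\infty\}$ that is $0$ on the regular strata. It induces a perversity on a link $L$ of $x$, with a given chart $\varphi$ as above: the value on a stratum $T$ of $L$ is the value of $\overline p$ on the stratum of $X$ that contains $\varphi(\{x\}\times\,]0,1[\,\times T)$. A singular simplex $\sigma\colon\Delta^\ell\to X$ is $\overline p$-allowable if $\dim\sigma^{-1}(S)\le \ell-\operatorname{codim}S+\overline p(S)$ for each singular stratum $S$, where $\dim A\le k$ means that $A$ is contained in a polyhedron (a finite union of simplices) of dimension at most $k$, and $\dim\emptyset=-\infty$; it is $\overline p$-full if it and all its iterated faces are $\overline p$-allowable. The $\overline p$-full simplices form a simplicial set $\mathscr G_{\overline p}X$, and the intersection homotopy groups are $\pi_\ell^{\overline p}(X,x_0)=\pi_\ell(\mathscr G_{\overline p}X,x_0)$ for a regular point $x_0$. **Proposition.**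 Let $X$ be a normal CS set with a perversity $\overline p$, let $S$ be a singular stratum of $X$, let $x_1,x_2\in S$, and let $L_1,L_2$ be links of $x_1,x_2$ respectively, with the perversities induced by $\overline p$, also denoted by $\overline p$. Then, for any $\ell\ge 1$ and any regular points $y_1\in L_1$, $y_2\in L_2$, there is a group isomorphism $$\pi_\ell^{\overline p}(L_1,y_1)\cong\pi_\ell^{\overline p}(L_2,y_2).$$ -/

import Mathlib

open CategoryTheory Simplicial Opposite

universe u

namespace Gajer

section Polyhedra

variable {E : Type*} [NormedAddCommGroup E] [NormedSpace ℝ E]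

/-- `Q` is a (compact) polyhedron of dimension at most `k`: a finite union of simplices,
each of them the convex hull of at most `k + 1` affinely independent points. -/
def IsPolyhedronOfDimLE (k : ℕ) (Q : Set E) : Prop :=
  ∃ T : Finset (Finset E),
    (∀ t ∈ T, AffineIndependent ℝ ((↑) : t → E) ∧ t.card ≤ k + 1) ∧
      Q = ⋃ t ∈ T, convexHull ℝ (t : Set E)

/-- The polyhedral dimension of `A` is at most `d`, where `d` is an integer or `±∞`: either `A`
is empty (its dimension is `-∞`), or `A` is contained in a polyhedron of some dimension `k ≤ d`. -/
def PolyDimLE (A : Set E) (d : WithBot (WithTop ℤ)) : Prop :=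
  A = ∅ ∨ ∃ k : ℕ, (((k : ℤ) : WithTop ℤ) : WithBot (WithTop ℤ)) ≤ d ∧
    ∃ Q : Set E, IsPolyhedronOfDimLE k Q ∧ A ⊆ Q

/-- A finite union of polyhedra is a polyhedron. -/
theorem IsPolyhedronOfDimLE.biUnion {ι : Type*} {k : ℕ} (s : Finset ι) (Q : ι → Set E)
    (h : ∀ i ∈ s, IsPolyhedronOfDimLE k (Q i)) : IsPolyhedronOfDimLE k (⋃ i ∈ s, Q i) := by
  classical
  choose! T hT using h
  refine ⟨s.biUnion T, ?_, ?_⟩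
  · intro t ht
    obtain ⟨i, hi, hti⟩ := Finset.mem_biUnion.1 ht
    exact (hT i hi).1 t hti
  · ext x
    simp only [Set.mem_iUnion, Finset.mem_biUnion]
    constructor
    · rintro ⟨i, hi, hx⟩
      rw [(hT i hi).2] at hx
      simp only [Set.mem_iUnion] at hx
      obtain ⟨t, ht, hx⟩ := hx
      exact ⟨t, ⟨i, hi, ht⟩, hx⟩
    · rintro ⟨t, ⟨i, hi, ht⟩, hx⟩
      refine ⟨i, hi, ?_⟩
      rw [(hT i hi).2]
      simp only [Set.mem_iUnion]
      exact ⟨t, ht, hx⟩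

/-- The convex hull of a finite subset of an affine subspace is a polyhedron. -/
theorem isPolyhedronOfDimLE_convexHull {k : ℕ} {D : Submodule ℝ E} [FiniteDimensional ℝ D]
    (hD : Module.finrank ℝ D ≤ k) (s : Set E) (hs : s.Finite) (hsD : vectorSpan ℝ s ≤ D) :
    IsPolyhedronOfDimLE k (convexHull ℝ s) := by
  classical
  refine ⟨hs.toFinset.powerset.filter (fun t => AffineIndependent ℝ ((↑) : t → E)), ?_, ?_⟩
  · intro t ht
    rw [Finset.mem_filter, Finset.mem_powerset] at ht
    refine ⟨ht.2, ?_⟩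
    have hle : vectorSpan ℝ (Set.range ((↑) : t → E)) ≤ D := by
      refine le_trans (vectorSpan_mono ℝ ?_) hsD
      rintro _ ⟨x, rfl⟩
      exact hs.mem_toFinset.1 (ht.1 x.2)
    have h1 := ht.2.card_le_finrank_succ
    rw [Fintype.card_coe] at h1
    have h2 := Submodule.finrank_mono hle
    omega
  · rw [convexHull_eq_union]
    ext x
    simp only [Set.mem_iUnion, Finset.mem_filter, Finset.mem_powerset]
    constructor
    · rintro ⟨t, hts, hti, hx⟩
      exact ⟨t, ⟨fun y hy => hs.mem_toFinset.2 (hts hy), hti⟩, hx⟩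
    · rintro ⟨t, ⟨hts, hti⟩, hx⟩
      exact ⟨t, fun y hy => hs.mem_toFinset.1 (hts hy), hti, hx⟩

/-- A bounded subset of an affine subspace of dimension `≤ k` is contained in a polyhedron of
dimension `≤ k`. -/
theorem exists_polyhedron_of_bounded [FiniteDimensional ℝ E] {k : ℕ} {A : Set E}
    (hA : Bornology.IsBounded A) (D : Submodule ℝ E) (hD : Module.finrank ℝ D ≤ k) (p : E)
    (hAD : ∀ a ∈ A, a - p ∈ D) : ∃ Q : Set E, IsPolyhedronOfDimLE k Q ∧ A ⊆ Q := by
  let e : D ≃L[ℝ] (Fin (Module.finrank ℝ D) → ℝ) :=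
    (Module.finBasis ℝ D).equivFun.toContinuousLinearEquiv
  let B : Set D := {v | p + (v : E) ∈ A}
  have hB : Bornology.IsBounded B := by
    obtain ⟨C, hC⟩ := hA.exists_norm_le
    refine (isBounded_iff_forall_norm_le).2 ⟨C + ‖p‖, fun v hv => ?_⟩
    have h1 : ‖p + (v : E)‖ ≤ C := hC _ hv
    have h2 : ‖(v : E)‖ ≤ ‖p + (v : E)‖ + ‖p‖ := by
      have := norm_sub_le (p + (v : E)) p
      simpa using this
    have h3 : ‖v‖ = ‖(v : E)‖ := rfl
    rw [h3]; linarith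
  have hB' : Bornology.IsBounded (e '' B) := e.toContinuousLinearMap.lipschitz.isBounded_image hB
  obtain ⟨M, hM⟩ := hB'.exists_norm_le
  let c : Set (Fin (Module.finrank ℝ D) → ℝ) := Set.univ.pi fun _ => {-M, M}
  have hc : c.Finite := Set.Finite.pi fun _ => by simp
  let f : (Fin (Module.finrank ℝ D) → ℝ) →ᵃ[ℝ] E :=
    (D.subtype ∘ₗ (e.symm : (Fin (Module.finrank ℝ D) → ℝ) →ₗ[ℝ] D)).toAffineMap +
      AffineMap.const ℝ _ p
  have hf : ∀ y, f y = (e.symm y : E) + p := fun y => rfl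
  refine ⟨convexHull ℝ (f '' c), isPolyhedronOfDimLE_convexHull hD _ (hc.image f) ?_, ?_⟩
  · rw [vectorSpan_def, Submodule.span_le]
    rintro _ ⟨_, ⟨y, _, rfl⟩, _, ⟨z, _, rfl⟩, rfl⟩
    simp only [hf, vsub_eq_sub, add_sub_add_right_eq_sub]
    exact D.sub_mem (e.symm y).2 (e.symm z).2
  · intro a ha
    rw [← AffineMap.image_convexHull, convexHull_pi]
    let v : D := ⟨a - p, hAD a ha⟩
    have hv : v ∈ B := by
      change p + (a - p) ∈ A
      simpa using ha
    refine ⟨e v, ?_, ?_⟩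
    · intro i _
      have h1 : ‖e v i‖ ≤ M := (norm_le_pi_norm _ i).trans (hM _ ⟨v, hv, rfl⟩)
      have hM0 : 0 ≤ M := (norm_nonneg _).trans h1
      rw [convexHull_pair, segment_eq_Icc (by linarith)]
      exact abs_le.1 h1
    · rw [hf]
      simp [v]

/-- The preimage of a polyhedron under a surjective linear map, intersected with a bounded set, is
contained in a polyhedron whose dimension is larger by at most the dimension of the kernel. -/
theorem exists_polyhedron_preimage {E' : Type*} [NormedAddCommGroup E'] [NormedSpace ℝ E']
    [FiniteDimensional ℝ E] [FiniteDimensional ℝ E'] (g : E' →ₗ[ℝ] E)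
    (hg : Function.Surjective g) {k r : ℕ}
    (hr : Module.finrank ℝ E' = Module.finrank ℝ E + r) {Q : Set E}
    (hQ : IsPolyhedronOfDimLE k Q) {A : Set E'} (hA : Bornology.IsBounded A)
    (hAQ : ∀ a ∈ A, g a ∈ Q) : ∃ Q' : Set E', IsPolyhedronOfDimLE (k + r) Q' ∧ A ⊆ Q' := by
  classical
  obtain ⟨T, hT, rfl⟩ := hQ
  have key : ∀ t ∈ T, ∃ Q' : Set E', IsPolyhedronOfDimLE (k + r) Q' ∧
      A ∩ g ⁻¹' (convexHull ℝ (t : Set E)) ⊆ Q' := by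
    intro t ht
    rcases t.eq_empty_or_nonempty with rfl | ⟨q, hq⟩
    · exact ⟨∅, ⟨∅, by simp, by simp⟩, by simp⟩
    obtain ⟨p, hp⟩ := hg q
    let W : Submodule ℝ E := vectorSpan ℝ (t : Set E)
    have hW : Module.finrank ℝ W ≤ k := by
      have h1 := finrank_vectorSpan_image_finset_le ℝ (fun x : E => x) t
        (n := t.card - 1) (by have := Finset.card_pos.2 ⟨q, hq⟩; omega)
      have h2 := (hT t ht).2
      rw [Finset.image_id'] at h1
      exact h1.trans (by omega)
    refine exists_polyhedron_of_bounded (hA.subset Set.inter_subset_left) (W.comap g) ?_ p ?_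
    · have hker : Module.finrank ℝ (LinearMap.ker g) = r := by
        have := LinearMap.finrank_range_add_finrank_ker g
        rw [LinearMap.range_eq_top.2 hg, finrank_top] at this
        omega
      let g' : W.comap g →ₗ[ℝ] W := g.restrict (fun x hx => hx)
      have h3 := LinearMap.finrank_range_add_finrank_ker g'
      have h4 : Module.finrank ℝ (LinearMap.range g') ≤ k := (Submodule.finrank_le _).trans hW
      have h5 : Module.finrank ℝ (LinearMap.ker g') ≤ Module.finrank ℝ (LinearMap.ker g) := by
        let i : LinearMap.ker g' →ₗ[ℝ] LinearMap.ker g :=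
          LinearMap.codRestrict _ ((W.comap g).subtype ∘ₗ (LinearMap.ker g').subtype) (by
            rintro ⟨x, hx⟩
            have := congrArg Subtype.val (LinearMap.mem_ker.1 hx)
            exact this)
        refine LinearMap.finrank_le_finrank_of_injective (f := i) ?_
        intro x y hxy
        have := congrArg Subtype.val hxy
        exact Subtype.ext (Subtype.ext this)
      omega
    · rintro a ⟨_, ha⟩
      change g (a - p) ∈ W
      rw [map_sub, hp]
      have h1 : g a ∈ affineSpan ℝ (t : Set E) := convexHull_subset_affineSpan _ ha
      have h2 : q ∈ affineSpan ℝ (t : Set E) := subset_affineSpan ℝ _ hq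
      have := AffineSubspace.vsub_mem_direction h1 h2
      rwa [direction_affineSpan] at this
  choose! P hP using key
  refine ⟨⋃ t ∈ T, P t, IsPolyhedronOfDimLE.biUnion T P fun t ht => (hP t ht).1, ?_⟩
  intro a ha
  have := hAQ a ha
  simp only [Set.mem_iUnion] at this ⊢
  obtain ⟨t, ht, hat⟩ := this
  exact ⟨t, ht, (hP t ht).2 ⟨ha, hat⟩⟩

end Polyhedra

section Filtered

variable {X : Type*} [TopologicalSpace X] {Y : Type*} [TopologicalSpace Y]

/-- A filtration `∅ = X_{-1} ⊆ X_0 ⊆ ⋯ ⊆ X_n = X` of the space `X` by closed subsets, of formal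
dimension `n`, indexed by the integers for convenience. -/
structure Filtration (X : Type*) [TopologicalSpace X] (n : ℕ) where
  skel : ℤ → Set X
  mono : Monotone skel
  isClosed : ∀ i, IsClosed (skel i)
  skel_neg : ∀ i, i < 0 → skel i = ∅
  skel_top : skel n = Set.univ

namespace Filtration

variable {n m : ℕ}

/-- `X` with this filtration is a filtered space: `X_{n-1} ≠ X_n`. In particular `X ≠ ∅`. -/
def IsFilteredSpace (F : Filtration X n) : Prop :=
  F.skel (n - 1) ≠ Set.univ

/-- `X^i = X_i \ X_{i-1}`. -/
def piece (F : Filtration X n) (i : ℤ) : Set X :=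
  F.skel i \ F.skel (i - 1)

/-- The strata of dimension `i` are the connected components of `X^i`. -/
structure Stratum (F : Filtration X n) where
  dim : ℤ
  carrier : Set X
  isComponent : ∃ x ∈ F.piece dim, carrier = connectedComponentIn (F.piece dim) x

/-- The formal codimension of a stratum. -/
def Stratum.codim {F : Filtration X n} (S : F.Stratum) : ℤ :=
  n - S.dim

/-- A stratum is singular if it lies in `X_{n-1}`, i.e. if its dimension is not `n`. -/
def Stratum.IsSingular {F : Filtration X n} (S : F.Stratum) : Prop :=
  S.dim ≠ n

/-- The filtration `f⁻¹(X_i)` pulled back along a continuous map. -/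
def comap (F : Filtration X n) (f : Y → X) (hf : Continuous f) : Filtration Y n where
  skel i := f ⁻¹' F.skel i
  mono _ _ h := Set.preimage_mono (F.mono h)
  isClosed i := (F.isClosed i).preimage hf
  skel_neg i hi := by rw [F.skel_neg i hi, Set.preimage_empty]
  skel_top := by rw [F.skel_top, Set.preimage_univ]

/-- The induced filtration `V ∩ X_i` on a subspace. -/
def induced (F : Filtration X n) (V : Set X) : Filtration V n :=
  F.comap Subtype.val continuous_subtype_val

/-- The product filtration `Y × X_i` on `Y × X`. -/
def prod (Y : Type*) [TopologicalSpace Y] (F : Filtration X n) : Filtration (Y × X) n :=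
  F.comap Prod.snd continuous_snd

theorem exists_mem_piece (F : Filtration X n) (x : X) : ∃ i, x ∈ F.piece i := by
  obtain ⟨i, hi, hmin⟩ := Int.exists_least_of_bdd (P := fun i => x ∈ F.skel i)
    ⟨0, fun z hz => by
      by_contra h
      rw [F.skel_neg z (by omega)] at hz
      exact hz⟩ ⟨n, by rw [F.skel_top]; trivial⟩
  exact ⟨i, hi, fun h => by have := hmin _ h; omega⟩

theorem le_of_mem_piece (F : Filtration X n) {x : X} {i : ℤ} (h : x ∈ F.piece i) : i ≤ n := by
  by_contra hlt
  refine h.2 (F.mono (show (n : ℤ) ≤ i - 1 by omega) ?_)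
  rw [F.skel_top]
  trivial

theorem Stratum.carrier_subset {F : Filtration X n} (S : F.Stratum) :
    S.carrier ⊆ F.piece S.dim := by
  obtain ⟨x, _, h⟩ := S.isComponent
  rw [h]
  exact connectedComponentIn_subset _ _

theorem Stratum.nonempty {F : Filtration X n} (S : F.Stratum) : S.carrier.Nonempty := by
  obtain ⟨x, hx, h⟩ := S.isComponent
  exact ⟨x, h ▸ mem_connectedComponentIn hx⟩

/-- The stratum containing the point `x`. -/
noncomputable def stratumAt (F : Filtration X n) (x : X) : F.Stratum where
  dim := (F.exists_mem_piece x).choose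
  carrier := connectedComponentIn (F.piece (F.exists_mem_piece x).choose) x
  isComponent := ⟨x, (F.exists_mem_piece x).choose_spec, rfl⟩

theorem mem_stratumAt (F : Filtration X n) (x : X) : x ∈ (F.stratumAt x).carrier :=
  mem_connectedComponentIn (F.exists_mem_piece x).choose_spec

/-- A stratified map: a continuous map that sends each stratum into a stratum of at most the
same codimension. -/
def IsStratifiedMap (F : Filtration X n) (G : Filtration Y m) (f : X → Y) : Prop :=
  Continuous f ∧ ∀ S : F.Stratum, ∃ T : G.Stratum, f '' S.carrier ⊆ T.carrier ∧ T.codim ≤ S.codim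

/-- A stratified homeomorphism. -/
def IsStratifiedHomeo (F : Filtration X n) (G : Filtration Y m) (f : X ≃ₜ Y) : Prop :=
  IsStratifiedMap F G f ∧ IsStratifiedMap G F f.symm

/-- A perversity: a map from the strata to `ℤ ∪ {±∞}` that vanishes on the regular strata. -/
structure Perversity (F : Filtration X n) where
  val : F.Stratum → WithBot (WithTop ℤ)
  regular : ∀ S : F.Stratum, ¬ S.IsSingular → val S = 0

end Filtration

end Filtered

section Cone

variable {L : Type*}

/-- The relation on `L × [0,1[` that collapses `L × {0}` to a point. -/
def coneSetoid (L : Type*) : Setoid (L × Set.Ico (0 : ℝ) 1) where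
  r a b := a = b ∨ ((a.2 : ℝ) = 0 ∧ (b.2 : ℝ) = 0)
  iseqv :=
    { refl := fun _ => Or.inl rfl
      symm := by
        rintro a b (h | h)
        · exact Or.inl h.symm
        · exact Or.inr h.symm
      trans := by
        rintro a b c (rfl | h) (rfl | h')
        · exact Or.inl rfl
        · exact Or.inr h'
        · exact Or.inr h
        · exact Or.inr ⟨h.1, h'.2⟩ }

/-- The open cone `L × [0,1[ / L × {0}` on a nonempty space `L`, with the quotient topology. -/
def OpenCone (L : Type*) : Type _ :=
  Quotient (coneSetoid L)

instance [TopologicalSpace L] : TopologicalSpace (OpenCone L) :=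
  inferInstanceAs (TopologicalSpace (Quotient (coneSetoid L)))

namespace OpenCone

/-- The point `[y, t]` of the open cone. -/
def mk (y : L) (t : Set.Ico (0 : ℝ) 1) : OpenCone L :=
  Quotient.mk (coneSetoid L) (y, t)

/-- The point `0` of `[0,1[`. -/
def zero : Set.Ico (0 : ℝ) 1 := ⟨0, by norm_num⟩

/-- The point `1/2` of `[0,1[`. -/
noncomputable def half : Set.Ico (0 : ℝ) 1 := ⟨1 / 2, by norm_num⟩

/-- The open cone on a subset `A` of `L`, as a subset of the open cone on `L`. It always contains
the apex `[-, 0]`; the open cone on the empty set consists of the apex only. -/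
def subcone (A : Set L) : Set (OpenCone L) :=
  {q | ∃ (y : L) (t : Set.Ico (0 : ℝ) 1), q = mk y t ∧ (y ∈ A ∨ t = zero)}

theorem mk_mem_subcone {A : Set L} {y : L} {t : Set.Ico (0 : ℝ) 1} :
    mk y t ∈ subcone A ↔ y ∈ A ∨ t = zero := by
  constructor
  · rintro ⟨y', t', h, h'⟩
    rcases Quotient.exact h with h | h
    · obtain ⟨rfl, rfl⟩ := Prod.mk.inj h
      exact h'
    · exact Or.inr (Subtype.ext h.1)
  · intro h
    exact ⟨y, t, rfl, h⟩

end OpenCone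

/-- The conical filtration on the open cone: its `i`-th skeleton is the open cone on `L_{i-1}`,
for `i ≥ 0`. -/
def Filtration.cone [TopologicalSpace L] {m : ℕ} (G : Filtration L m) : Filtration (OpenCone L) (m + 1) where
  skel i := if i < 0 then ∅ else OpenCone.subcone (G.skel (i - 1))
  mono i j hij := by
    dsimp only
    split_ifs with h1 h2 h2
    · exact subset_rfl
    · exact Set.empty_subset _
    · omega
    · rintro _ ⟨y, t, rfl, h⟩
      exact ⟨y, t, rfl, h.imp_left fun h => G.mono (by omega) h⟩
  isClosed i := by
    split_ifs with h
    · exact isClosed_empty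
    · have : IsClosed ((Quotient.mk (coneSetoid L)) ⁻¹' (OpenCone.subcone (G.skel (i - 1)))) := by
        have h1 : (Quotient.mk (coneSetoid L)) ⁻¹' (OpenCone.subcone (G.skel (i - 1))) =
            (Prod.fst ⁻¹' G.skel (i - 1)) ∪ (Prod.snd ⁻¹' {OpenCone.zero}) := by
          ext ⟨y, t⟩
          exact OpenCone.mk_mem_subcone
        rw [h1]
        exact ((G.isClosed _).preimage continuous_fst).union
          (isClosed_singleton.preimage continuous_snd)
      exact isQuotientMap_quotient_mk'.isClosed_preimage.1 this
  skel_neg i hi := by simp [hi]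
  skel_top := by
    rw [if_neg (by omega), Set.eq_univ_iff_forall]
    intro q
    induction q using Quotient.inductionOn with
    | h a =>
      refine OpenCone.mk_mem_subcone.2 (Or.inl ?_)
      have : ((m + 1 : ℕ) : ℤ) - 1 = m := by push_cast; ring
      rw [this, G.skel_top]
      trivial

end Cone

section CSSets

variable {X : Type*} [TopologicalSpace X] {n : ℕ}

/-- A topological manifold of dimension `i` (possibly empty): Hausdorff and locally Euclidean.
Second countability is not imposed. -/
def IsTopManifold (i : ℕ) (M : Type*) [TopologicalSpace M] : Prop :=
  T2Space M ∧ Nonempty (ChartedSpace (EuclideanSpace ℝ (Fin i)) M)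

/-- A conical chart of the point `x ∈ X_i \ X_{i-1}`, where `i ≠ n`, whose link is the space `L`
with the filtration `G`. -/
structure ConicalChart (F : Filtration X n) (x : X) {L : Type*} [TopologicalSpace L] {m : ℕ}
    (G : Filtration L m) where
  i : ℕ
  mem_piece : x ∈ F.piece i
  dim_eq : i + m + 1 = n
  compactSpace : CompactSpace L
  t2Space : T2Space L
  isFilteredSpace : G.IsFilteredSpace
  V : Set X
  isOpen_V : IsOpen V
  mem_V : x ∈ V
  U : Set X
  isOpen_U : ∃ O : Set X, IsOpen O ∧ U = O ∩ F.piece i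
  mem_U : x ∈ U
  φ : (U × OpenCone L) ≃ₜ V
  isStratifiedHomeo : Filtration.IsStratifiedHomeo (G.cone.prod U) (F.induced V) φ
  image_skel : ∀ j : ℤ, 0 ≤ j → j ≤ m →
    (fun q => (φ q : X)) '' (Set.univ ×ˢ OpenCone.subcone (G.skel j)) = V ∩ F.skel (i + j + 1)
  apex : ∀ (u : U) (y : L), (φ (u, OpenCone.mk y OpenCone.zero) : X) = u

/-- A CS set of dimension `n`: each `X^i` is a topological manifold of dimension `i` (so its
components, the strata, are open in it and are manifolds of dimension `i`), and each singular point
has a conical chart. -/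
structure Filtration.IsCSSet {X : Type u} [TopologicalSpace X] (F : Filtration X n) : Prop where
  isFilteredSpace : F.IsFilteredSpace
  isTopManifold : ∀ i : ℕ, IsTopManifold i (F.piece i)
  exists_chart : ∀ x ∈ F.skel (n - 1), ∃ (L : Type u) (_ : TopologicalSpace L) (m : ℕ)
    (G : Filtration L m), Nonempty (ConicalChart F x G)

/-- Normality: all the links of all the singular points are connected. (A link of a point of `X`
is homeomorphic to a subspace of `X`, so links in the universe of `X` are enough.) -/
def Filtration.IsNormal {X : Type u} [TopologicalSpace X] (F : Filtration X n) : Prop :=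
  ∀ (x : X) (L : Type u) [TopologicalSpace L] (m : ℕ) (G : Filtration L m),
    ConicalChart F x G → ConnectedSpace L

variable {F : Filtration X n} {x : X} {L : Type*} [TopologicalSpace L] {m : ℕ} {G : Filtration L m}

/-- The embedding `y ↦ φ(x, [y, 1/2])` of the link into `X`. -/
noncomputable def ConicalChart.incl (c : ConicalChart F x G) (y : L) : X :=
  c.φ (⟨x, c.mem_U⟩, OpenCone.mk y OpenCone.half)

/-- Regular points of the link lie on regular points of `X`. -/
theorem ConicalChart.stratumAt_incl_regular (c : ConicalChart F x G) {y : L}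
    (hy : y ∉ G.skel (m - 1)) : ¬ (F.stratumAt (c.incl y)).IsSingular := by
  set z : c.U × OpenCone L := (⟨x, c.mem_U⟩, OpenCone.mk y OpenCone.half) with hz
  have hdim : (((G.cone.prod c.U).stratumAt z).dim : ℤ) = (m + 1 : ℕ) := by
    have h1 := ((G.cone.prod c.U).stratumAt z).carrier_subset ((G.cone.prod c.U).mem_stratumAt z)
    refine le_antisymm (Filtration.le_of_mem_piece _ h1) ?_
    by_contra hlt
    have h2 : z ∈ (G.cone.prod c.U).skel m :=
      (G.cone.prod c.U).mono (by push_cast at hlt; omega) h1.1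
    have h3 : OpenCone.mk y OpenCone.half ∈ G.cone.skel m := h2
    simp only [Filtration.cone] at h3
    rw [if_neg (by omega), OpenCone.mk_mem_subcone] at h3
    rcases h3 with h3 | h3
    · exact hy h3
    · have := congrArg Subtype.val h3
      norm_num [OpenCone.half, OpenCone.zero] at this
  obtain ⟨T, hT, hcod⟩ := c.isStratifiedHomeo.1.2 ((G.cone.prod c.U).stratumAt z)
  have hzT : c.φ z ∈ (F.induced c.V).piece T.dim :=
    T.carrier_subset (hT ⟨z, (G.cone.prod c.U).mem_stratumAt z, rfl⟩)
  have hTle := Filtration.le_of_mem_piece _ hzT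
  simp only [Filtration.Stratum.codim, hdim] at hcod
  have hTn : T.dim = n := by omega
  rw [hTn] at hzT
  have hnot : c.incl y ∉ F.skel (n - 1) := hzT.2
  have h4 := (F.stratumAt (c.incl y)).carrier_subset (F.mem_stratumAt (c.incl y))
  have h5 := Filtration.le_of_mem_piece _ h4
  intro hne
  exact hnot (F.mono (by have : (F.stratumAt (c.incl y)).dim ≠ n := hne; omega) h4.1)

/-- The perversity induced on the link: the value on a stratum `T` of `L` is the value on the
stratum of `X` that contains the connected set `φ({x} × ]0,1[ × T)`; it is read off at one point of
this set, and does not depend on the choice of that point. -/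
noncomputable def ConicalChart.perversity (c : ConicalChart F x G) (p : F.Perversity) :
    G.Perversity where
  val T := p.val (F.stratumAt (c.incl T.nonempty.choose))
  regular T hT := by
    refine p.regular _ (c.stratumAt_incl_regular ?_)
    have h := (T.carrier_subset T.nonempty.choose_spec).2
    have hd : T.dim = m := not_not.1 hT
    rwa [hd] at h

end CSSets

section GajerSpace

variable {X : Type*} [TopologicalSpace X] {n : ℕ} {F : Filtration X n}

/-- The affine map between standard simplices induced by a map of the vertices. -/
noncomputable def simplexMap {a b : ℕ} (f : Fin (a + 1) → Fin (b + 1)) :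
    C(stdSimplex ℝ (Fin (a + 1)), stdSimplex ℝ (Fin (b + 1))) :=
  ⟨stdSimplex.map f, stdSimplex.continuous_map f⟩

/-- A singular simplex `σ` is `p`-allowable if `dim σ⁻¹(S) ≤ ℓ - codim S + p(S)` for each singular
stratum `S`. -/
def IsAllowable (p : F.Perversity) {ℓ : ℕ} (σ : C(stdSimplex ℝ (Fin (ℓ + 1)), X)) : Prop :=
  ∀ S : F.Stratum, S.IsSingular →
    PolyDimLE (E := Fin (ℓ + 1) → ℝ) (Subtype.val '' (σ ⁻¹' S.carrier))
      (((((ℓ : ℤ) - S.codim : ℤ) : WithTop ℤ) : WithBot (WithTop ℤ)) + p.val S)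

/-- A singular simplex is `p`-full if it and all its iterated faces are `p`-allowable. -/
def IsFull (p : F.Perversity) {ℓ : ℕ} (σ : C(stdSimplex ℝ (Fin (ℓ + 1)), X)) : Prop :=
  ∀ (k : ℕ) (δ : Fin (k + 1) ↪o Fin (ℓ + 1)), IsAllowable p (σ.comp (simplexMap δ))

theorem IsAllowable.comp_surjective {p : F.Perversity} {i j : ℕ}
    {τ : C(stdSimplex ℝ (Fin (i + 1)), X)} (hτ : IsAllowable p τ) (s : Fin (j + 1) → Fin (i + 1))
    (hs : Function.Surjective s) : IsAllowable p (τ.comp (simplexMap s)) := by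
  intro S hS
  have hij : i ≤ j := by
    have := Fintype.card_le_of_surjective s hs
    simp only [Fintype.card_fin] at this
    omega
  rcases hτ S hS with h | ⟨k, hk, Q, hQ, hAQ⟩
  · left
    rw [Set.image_eq_empty] at h ⊢
    rw [Set.eq_empty_iff_forall_notMem] at h ⊢
    intro z hz
    exact h (simplexMap s z) hz
  · right
    refine ⟨k + (j - i), ?_, ?_⟩
    · generalize p.val S = q at hk ⊢
      induction q with
      | bot => simp at hk
      | coe q =>
        induction q with
        | top => rw [← WithBot.coe_add]; simp
        | coe q =>
          norm_cast at hk ⊢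
          push_cast [hij]
          omega
    · refine exists_polyhedron_preimage (FunOnFinite.linearMap ℝ ℝ s) ?_ ?_ hQ
        ((bounded_stdSimplex _).subset ?_) ?_
      · intro w
        obtain ⟨r, hr⟩ := hs.hasRightInverse
        refine ⟨FunOnFinite.linearMap ℝ ℝ r w, ?_⟩
        have : s ∘ r = id := funext hr
        rw [← LinearMap.comp_apply, ← FunOnFinite.linearMap_comp, this]
        simp
      · simp only [Module.finrank_fintype_fun_eq_card, Fintype.card_fin]
        omega
      · rintro _ ⟨z, _, rfl⟩
        exact z.2
      · rintro _ ⟨z, hz, rfl⟩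
        exact hAQ ⟨simplexMap s z, hz, rfl⟩

theorem IsFull.comp_monotone {p : F.Perversity} {a ℓ : ℕ} {σ : C(stdSimplex ℝ (Fin (ℓ + 1)), X)}
    (hσ : IsFull p σ) (f : Fin (a + 1) → Fin (ℓ + 1)) : IsFull p (σ.comp (simplexMap f)) := by
  classical
  intro j ι
  let I : Finset (Fin (ℓ + 1)) := Finset.univ.image (f ∘ ι)
  have hI : I.card = (I.card - 1) + 1 := by
    have : 0 < I.card := Finset.card_pos.2 (Finset.univ_nonempty.image _)
    omega
  let δ : Fin ((I.card - 1) + 1) ↪o Fin (ℓ + 1) := I.orderEmbOfFin hI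
  have hδ : Set.range δ = I := Finset.range_orderEmbOfFin I hI
  have hex : ∀ v, ∃ u, δ u = f (ι v) := fun v => by
    have : f (ι v) ∈ Set.range δ := by
      rw [hδ]
      exact Finset.mem_coe.2 (Finset.mem_image.2 ⟨v, Finset.mem_univ _, rfl⟩)
    exact this
  choose s hs using hex
  have hsurj : Function.Surjective s := by
    intro u
    have : δ u ∈ (I : Set (Fin (ℓ + 1))) := hδ ▸ Set.mem_range_self u
    obtain ⟨v, _, hv⟩ := Finset.mem_image.1 (Finset.mem_coe.1 this)
    exact ⟨v, δ.injective ((hs v).trans hv)⟩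
  have heq : (σ.comp (simplexMap f)).comp (simplexMap ι) =
      (σ.comp (simplexMap δ)).comp (simplexMap s) := by
    ext z
    change σ (stdSimplex.map f (stdSimplex.map ι z)) = σ (stdSimplex.map δ (stdSimplex.map s z))
    rw [stdSimplex.map_comp_apply, stdSimplex.map_comp_apply]
    congr 2
    exact funext fun v => (hs v).symm
  rw [heq]
  exact (hσ _ δ).comp_surjective s hsurj

/-- The constant simplices at a regular point are full. -/
theorem isFull_of_regular (p : F.Perversity) {ℓ : ℕ} {σ : C(stdSimplex ℝ (Fin (ℓ + 1)), X)}
    (hσ : ∀ z, σ z ∉ F.skel (n - 1)) : IsFull p σ := by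
  intro k δ S hS
  left
  rw [Set.image_eq_empty, Set.eq_empty_iff_forall_notMem]
  intro z hz
  have h1 := S.carrier_subset hz
  have h2 := Filtration.le_of_mem_piece _ h1
  exact hσ _ (F.mono (by have : S.dim ≠ n := hS; omega) h1.1)

end GajerSpace

section HomotopyGroups

variable {X : Type u} [TopologicalSpace X] {n : ℕ} {F : Filtration X n}

/-- The Gajer space of `(X, p)`: the simplicial set of the `p`-full simplices, a subcomplex of
the singular simplicial set. -/
def gajerSpace (p : F.Perversity) : (TopCat.toSSet.obj (TopCat.of X)).Subcomplex where
  obj k := {σ | IsFull p (TopCat.toSSetObjEquiv (TopCat.of X) k σ)}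
  map f _ hσ := IsFull.comp_monotone hσ f.unop

/-- A regular point as a vertex of the Gajer space. -/
noncomputable def gajerVertex (p : F.Perversity) (x₀ : X) (hx₀ : x₀ ∉ F.skel (n - 1)) :
    (gajerSpace p : SSet.{u}) _⦋0⦌ :=
  ⟨TopCat.toSSetObj₀Equiv.symm x₀, isFull_of_regular (ℓ := 0) p fun _ => hx₀⟩

/-- The point of the geometric realization given by a vertex of a simplicial set. -/
noncomputable def realizationPoint (K : SSet.{u}) (v : K _⦋0⦌) : SSet.toTop.obj K :=
  SSet.toTop.map (SSet.yonedaEquiv.symm v : Δ[0] ⟶ K)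
    (default : (SSet.toTop.obj (Δ[0] : SSet.{u}) : TopCat.{u}))

/-- The `p`-intersection homotopy group `π_ℓ^p(X, x₀)`: the `ℓ`-th homotopy group of the Gajer
space, based at a regular point `x₀` of `X`. (It is a group for `ℓ ≥ 1`; homotopy groups of a
simplicial set are those of its geometric realization.) -/
abbrev IntersectionHomotopyGroup (ℓ : ℕ) (p : F.Perversity) (x₀ : X)
    (hx₀ : x₀ ∉ F.skel (n - 1)) : Type u :=
  HomotopyGroup.Pi ℓ (SSet.toTop.obj (gajerSpace p : SSet.{u}))
    (realizationPoint (gajerSpace p : SSet.{u}) (gajerVertex p x₀ hx₀))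

end HomotopyGroups

end Gajer

/-! The singular stratum is connected, so the claim can be proved locally along it and then chained.
A conical chart at `x` is also a conical chart, with the same link, at every nearby point of the
stratum. It induces there the same perversity, because moving the base point inside the chart does
not change the stratum of `X` on which a point of the link lies
(`ConicalChart.eventually_perversity_eq`). What remains is to compare two links `L₁`, `L₂` of one
and the same point.

Conical neighborhoods of a point can be nested in each other. A small copy of `L₁` lies in the
punctured cone over `L₂` and projects to `L₂`; likewise in the other direction. In the coordinates
of the second cone, a straight-line move in the ball and height directions deforms the composite to
the identity of `L₁` (`ConeCoords.exists_homotopy_transfer`). Every map and homotopy involved keeps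
the label of a point, that is, the stratum of `X` on which it lies. The label determines codimension
and induced perversity, and a link has finitely many strata. As polyhedral dimension bounds survive
finite unions, fullness of simplices is preserved, for an arbitrary continuous choice of the time
parameter (`IsFull.of_label`, `Filtration.IsCSSet.finite_stratum`).

Such a homotopy induces a homotopy of realizations of Gajer spaces (`PreservesFull.homotopic`). A
simplex `Δ → X` and the homotopy give one simplex on the join `Δ * Δ`, full because it is the
homotopy applied to a full simplex and a time function; the segments of the join joining the two
copies of a point are the tracks of the homotopy.

These homotopies do not fix base points. The isomorphism on homotopy groups therefore needs the
action of paths (`HomotopyGroup.changeBaseEquiv`), and the image of the first base point has to be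
joined to the second one in the regular part of the link. Here normality enters: by induction on the
codimension, every point has arbitrarily small neighborhoods whose regular part is connected, so the
regular part of a link is path connected (`Filtration.IsCSSet.joinedIn_regular`). -/

namespace GenLoop

open scoped unitInterval Topology Topology.Homotopy

/-! ### Transport of cubical loops along paths. -/

section Cube

variable {N : Type*}

/-- Twice the distance of a point of the cube to the centre, for the supremum norm. -/
noncomputable def radius [Fintype N] (y : N → I) : ℝ := ‖fun i => 2 * (y i : ℝ) - 1‖

/-- The dilation of the cube about its centre, followed by the retraction onto the cube. -/
noncomputable def dilate (c : ℝ) (y : N → I) : N → I :=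
  fun i => Set.projIcc 0 1 zero_le_one (1 / 2 + c * ((y i : ℝ) - 1 / 2))

theorem continuous_radius [Fintype N] : Continuous (radius : (N → I) → ℝ) := by
  unfold radius; fun_prop

theorem continuous_dilate : Continuous fun q : ℝ × (N → I) => dilate q.1 q.2 := by
  unfold dilate
  refine continuous_pi fun i => continuous_projIcc.comp ?_
  fun_prop

theorem dilate_one (y : N → I) : dilate 1 y = y := by
  funext i
  have : 1 / 2 + 1 * ((y i : ℝ) - 1 / 2) = y i := by ring
  rw [dilate, this, Set.projIcc_val]

theorem radius_le_one [Fintype N] (y : N → I) : radius y ≤ 1 := by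
  refine (pi_norm_le_iff_of_nonneg zero_le_one).2 fun i => ?_
  rw [Real.norm_eq_abs, abs_le]
  constructor <;> linarith [(y i).2.1, (y i).2.2]

theorem radius_of_mem_boundary [Fintype N] {y : N → I} (hy : y ∈ Cube.boundary N) : radius y = 1 := by
  refine le_antisymm (radius_le_one y) ?_
  obtain ⟨i, hi⟩ := hy
  refine le_trans ?_ (norm_le_pi_norm (fun i => 2 * (y i : ℝ) - 1) i)
  rcases hi with hi | hi <;> norm_num [hi]

/-- A coordinate at which the supremum norm is attained is pushed to or past an end of `[0, 1]`, and
the retraction puts it at that end. -/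
theorem dilate_mem_boundary [Fintype N] [Nonempty N] {c : ℝ} {y : N → I} (h : 1 ≤ c * radius y)
    (hc : 0 ≤ c) : dilate c y ∈ Cube.boundary N := by
  obtain ⟨i, -, hi⟩ := Finset.exists_max_image Finset.univ
    (fun i => ‖2 * (y i : ℝ) - 1‖) Finset.univ_nonempty
  have hr : radius y ≤ ‖2 * (y i : ℝ) - 1‖ :=
    (pi_norm_le_iff_of_nonneg (norm_nonneg _)).2 fun j => hi j (Finset.mem_univ j)
  have h1 : 1 ≤ c * abs (2 * (y i : ℝ) - 1) := h.trans (mul_le_mul_of_nonneg_left hr hc)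
  refine ⟨i, ?_⟩
  rcases abs_cases (2 * (y i : ℝ) - 1) with ⟨h2, -⟩ | ⟨h2, -⟩ <;> rw [h2] at h1
  · right
    exact Set.projIcc_of_right_le _ (by nlinarith)
  · left
    exact Set.projIcc_of_le_left _ (by nlinarith)

end Cube

variable {N : Type*} {X : Type*} [TopologicalSpace X] {x x₁ x₂ : X}

/-- `q` is obtained from `p` by a homotopy that moves the boundary of the cube along `γ`. -/
def HomotopicAlong (γ : Path x x₁) (p : Ω^ N X x) (q : Ω^ N X x₁) : Prop :=
  ∃ H : ContinuousMap.Homotopy p.1 q.1, ∀ t, ∀ y ∈ Cube.boundary N, H (t, y) = γ t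

theorem HomotopicAlong.symm {γ : Path x x₁} {p : Ω^ N X x} {q : Ω^ N X x₁}
    (h : HomotopicAlong γ p q) : HomotopicAlong γ.symm q p := by
  obtain ⟨H, hH⟩ := h
  exact ⟨H.symm, fun t y hy => hH _ y hy⟩

theorem HomotopicAlong.trans {γ : Path x x₁} {δ : Path x₁ x₂} {p : Ω^ N X x} {q : Ω^ N X x₁}
    {r : Ω^ N X x₂} (h : HomotopicAlong γ p q) (h' : HomotopicAlong δ q r) :
    HomotopicAlong (γ.trans δ) p r := by
  obtain ⟨H, hH⟩ := h
  obtain ⟨H', hH'⟩ := h'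
  refine ⟨H.trans H', fun t y hy => ?_⟩
  rw [ContinuousMap.Homotopy.trans_apply, Path.trans_apply]
  split_ifs
  · exact hH _ y hy
  · exact hH' _ y hy

theorem Homotopic.homotopicAlong {p q : Ω^ N X x} (h : Homotopic p q) :
    HomotopicAlong (Path.refl x) p q := by
  obtain ⟨H⟩ := h
  exact ⟨H.toHomotopy, fun t y hy => (H.eq_fst t hy).trans (p.2 y hy)⟩

section Squeeze

variable [Fintype N] [Nonempty N]

/-- A family of loops `h t`, of which the boundary values are `d t 0`, is squeezed to a concentric
cube and extended by `d t` along the radii. -/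
theorem continuous_squeeze {T : Type*} [TopologicalSpace T] {c : T → ℝ} (hc : Continuous c)
    (hc0 : ∀ t, 0 ≤ c t) {h : T → (N → I) → X} (hh : Continuous fun q : T × (N → I) => h q.1 q.2)
    {d : T → ℝ → X} (hd : Continuous fun q : T × ℝ => d q.1 q.2)
    (hb : ∀ t, ∀ y ∈ Cube.boundary N, h t y = d t 0) :
    Continuous fun q : T × (N → I) =>
      if c q.1 * radius q.2 ≤ 1 then h q.1 (dilate (c q.1) q.2)
        else d q.1 (c q.1 * radius q.2 - 1) := by
  have hr := continuous_radius (N := N)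
  refine Continuous.if_le ?_ ?_ (by fun_prop) continuous_const ?_
  · exact hh.comp (continuous_fst.prodMk (continuous_dilate.comp
      ((hc.comp continuous_fst).prodMk continuous_snd)))
  · exact hd.comp (continuous_fst.prodMk (by fun_prop))
  · rintro ⟨t, y⟩ h1
    dsimp only at h1 ⊢
    rw [hb t _ (dilate_mem_boundary h1.ge (hc0 t)), h1, sub_self]

/-- At time `t` the loop `p` is squeezed into the concentric cube of side `1 / (1 + t)`, and the
collar runs radially along `γ` up to `γ t`. -/
theorem exists_homotopicAlong (γ : Path x x₁) (p : Ω^ N X x) :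
    ∃ q : Ω^ N X x₁, HomotopicAlong γ p q := by
  have hcont := continuous_squeeze (N := N) (T := I) (c := fun t => 1 + (t : ℝ)) (by fun_prop)
    (fun t => by linarith [t.2.1]) (h := fun _ => p) (p.1.continuous.comp continuous_snd)
    (d := fun _ => γ.extend) (γ.continuous_extend.comp continuous_snd) (fun t y hy => by
      rw [γ.extend_zero]; exact p.2 y hy)
  set H : I × (N → I) → X := fun q => if (1 + (q.1 : ℝ)) * radius q.2 ≤ 1 then
    p (dilate (1 + (q.1 : ℝ)) q.2) else γ.extend ((1 + (q.1 : ℝ)) * radius q.2 - 1) with hHdef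
  have hb : ∀ t, ∀ y ∈ Cube.boundary N, H (t, y) = γ t := by
    intro t y hy
    simp only [hHdef, radius_of_mem_boundary hy, mul_one, add_sub_cancel_left]
    split_ifs with h
    · have h0 : t = 0 := Subtype.ext (le_antisymm (by simpa using h) t.2.1)
      rw [h0, γ.source, Set.Icc.coe_zero, add_zero, dilate_one]
      exact p.2 y hy
    · exact γ.extend_apply t.2
  refine ⟨⟨⟨fun y => H (1, y), hcont.comp (by fun_prop)⟩, fun y hy => ?_⟩,
    ⟨⟨⟨H, hcont⟩, fun y => ?_, fun y => rfl⟩, hb⟩⟩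
  · exact (hb 1 y hy).trans γ.target
  · change H (0, y) = p y
    simp only [hHdef, Set.Icc.coe_zero, add_zero, one_mul, radius_le_one, if_true, dilate_one]

/-- Dilations by a factor `1 + t ≥ 1` keep the boundary on the boundary, so they connect the two
loops through loops. -/
theorem homotopic_dilate (p q : Ω^ N X x) (h : ∀ y, q y = p (dilate 2 y)) : Homotopic p q := by
  have hb : ∀ t : I, ∀ y ∈ Cube.boundary N, p (dilate (1 + (t : ℝ)) y) = x := fun t y hy =>
    p.2 _ (dilate_mem_boundary (by rw [radius_of_mem_boundary hy]; linarith [t.2.1])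
      (by linarith [t.2.1]))
  refine ⟨⟨⟨⟨fun z => p (dilate (1 + (z.1 : ℝ)) z.2), p.1.continuous.comp
    (continuous_dilate.comp (((continuous_const.add continuous_subtype_val).comp
      continuous_fst).prodMk continuous_snd))⟩, fun y => ?_, fun y => ?_⟩, fun t y hy => ?_⟩⟩
  · change p (dilate (1 + ((0 : I) : ℝ)) y) = p y
    rw [Set.Icc.coe_zero, add_zero, dilate_one]
  · change p (dilate (1 + ((1 : I) : ℝ)) y) = q y
    rw [Set.Icc.coe_one, h, one_add_one_eq_two]
  · exact (hb t y hy).trans (p.2 y hy).symm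

/-- The homotopy is squeezed into the half-size cube and the collar is filled with the contraction
of `δ`, which makes the boundary stationary. The price is a dilation by 2 at both ends, harmless by
`homotopic_dilate`. -/
theorem HomotopicAlong.homotopic {δ : Path x x} (hδ : δ.Homotopic (Path.refl x))
    {p q : Ω^ N X x} (h : HomotopicAlong δ p q) : Homotopic p q := by
  obtain ⟨H, hH⟩ := h
  obtain ⟨D⟩ := hδ
  have hcont := continuous_squeeze (N := N) (T := I) (c := fun _ => 2) continuous_const
    (fun t => zero_le_two) (h := fun t y => H (t, y)) H.continuous
    (d := fun t s => D (Set.projIcc 0 1 zero_le_one s, t))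
    (D.continuous.comp ((continuous_projIcc.comp continuous_snd).prodMk continuous_fst))
    (fun t y hy => by
      rw [hH t y hy, Set.projIcc_left]
      exact (D.apply_zero t).symm)
  set K : I × (N → I) → X := fun z => if (2 : ℝ) * radius z.2 ≤ 1 then H (z.1, dilate 2 z.2)
    else D (Set.projIcc 0 1 zero_le_one (2 * radius z.2 - 1), z.1) with hK
  have hbd : ∀ t, ∀ y ∈ Cube.boundary N, K (t, y) = x := by
    intro t y hy
    simp only [hK, radius_of_mem_boundary hy]
    rw [if_neg (by norm_num), Set.projIcc_of_right_le _ (by norm_num)]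
    exact D.apply_one t
  -- At the two ends the contraction of `δ` is constant, so the collar agrees with the dilated loop.
  have hend : ∀ t : I, (t = 0 ∨ t = 1) → ∀ y, K (t, y) = H (t, dilate 2 y) := by
    intro t ht y
    have hDx : ∀ s, D (s, t) = x := fun s => by
      rcases ht with rfl | rfl
      · exact D.source s
      · exact D.target s
    simp only [hK]
    split_ifs with h1
    · rfl
    · rw [hDx, hH t _ (dilate_mem_boundary (not_le.1 h1).le zero_le_two)]
      rcases ht with rfl | rfl
      · exact δ.source.symm
      · exact δ.target.symm
  let p' : Ω^ N X x := ⟨⟨fun y => K (0, y), hcont.comp (by fun_prop)⟩, hbd 0⟩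
  let q' : Ω^ N X x := ⟨⟨fun y => K (1, y), hcont.comp (by fun_prop)⟩, hbd 1⟩
  have hp : Homotopic p p' := homotopic_dilate _ _ fun y =>
    (hend 0 (Or.inl rfl) y).trans (H.apply_zero _)
  have hq : Homotopic q q' := homotopic_dilate _ _ fun y =>
    (hend 1 (Or.inr rfl) y).trans (H.apply_one _)
  refine hp.trans (Homotopic.trans ?_ hq.symm)
  exact ⟨⟨⟨⟨K, hcont⟩, fun y => rfl, fun y => rfl⟩, fun t y hy =>
    (hbd t y hy).trans (hbd 0 y hy).symm⟩⟩

/-- Going back along `γ`, across the given homotopy and forth along `γ` moves the boundary along a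
null-homotopic loop. This makes transport along `γ` well defined on homotopy classes. -/
theorem HomotopicAlong.unique {γ : Path x x₁} {p p' : Ω^ N X x} {q q' : Ω^ N X x₁}
    (h : HomotopicAlong γ p q) (h' : HomotopicAlong γ p' q') (hp : Homotopic p p') :
    Homotopic q q' := by
  refine ((h.symm.trans hp.homotopicAlong).trans h').homotopic ?_
  have h1 : (γ.symm.trans (Path.refl x)).Homotopic γ.symm := ⟨Path.Homotopy.transRefl _⟩
  exact (h1.hcomp (Path.Homotopic.refl γ)).trans ⟨(Path.Homotopy.reflSymmTrans γ).symm⟩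

end Squeeze

theorem HomotopicAlong.transAt [DecidableEq N] (i : N) {γ : Path x x₁} {p p' : Ω^ N X x}
    {q q' : Ω^ N X x₁} (h : HomotopicAlong γ p q) (h' : HomotopicAlong γ p' q') :
    HomotopicAlong γ (transAt i p p') (transAt i q q') := by
  obtain ⟨H, hH⟩ := h
  obtain ⟨H', hH'⟩ := h'
  set K : I × (N → I) → X := fun z => if (z.2 i : ℝ) ≤ 1 / 2
      then H (z.1, Function.update z.2 i <| Set.projIcc 0 1 zero_le_one (2 * z.2 i))
      else H' (z.1, Function.update z.2 i <| Set.projIcc 0 1 zero_le_one (2 * z.2 i - 1)) with hK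
  have hcont : Continuous K := by
    refine Continuous.if_le ?_ ?_ (by fun_prop) continuous_const ?_
    · refine H.continuous.comp (continuous_fst.prodMk (continuous_snd.update i ?_))
      exact continuous_projIcc.comp (by fun_prop)
    · refine H'.continuous.comp (continuous_fst.prodMk (continuous_snd.update i ?_))
      exact continuous_projIcc.comp (by fun_prop)
    · rintro ⟨t, y⟩ hy
      dsimp only at hy ⊢
      -- On the wall `y i = 1 / 2` both rescaled points lie on faces of the cube, where both
      -- homotopies take the value `γ t`.
      rw [hH, hH']
      · refine ⟨i, Or.inl ?_⟩
        rw [Function.update_self]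
        exact Set.projIcc_of_le_left _ (by rw [hy]; norm_num)
      · refine ⟨i, Or.inr ?_⟩
        rw [Function.update_self]
        exact Set.projIcc_of_right_le _ (by rw [hy]; norm_num)
  refine ⟨⟨⟨K, hcont⟩, fun y => ?_, fun y => ?_⟩, fun t y hy => ?_⟩
  · change K (0, y) = (GenLoop.transAt i p p') y
    simp only [hK, H.apply_zero, H'.apply_zero, GenLoop.transAt, coe_copy]
    rfl
  · change K (1, y) = (GenLoop.transAt i q q') y
    simp only [hK, H.apply_one, H'.apply_one, GenLoop.transAt, coe_copy]
    rfl
  · change K (t, y) = γ t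
    have key : ∀ s : ℝ, (y i = 0 ∧ s ≤ 0 ∨ y i = 1 ∧ 1 ≤ s ∨ ∃ j ≠ i, y j = 0 ∨ y j = 1) →
        Function.update y i (Set.projIcc 0 1 zero_le_one s) ∈ Cube.boundary N := by
      rintro s (⟨-, h⟩ | ⟨-, h⟩ | ⟨j, hj, h⟩)
      · exact ⟨i, Or.inl (by rw [Function.update_self]; exact Set.projIcc_of_le_left _ h)⟩
      · exact ⟨i, Or.inr (by rw [Function.update_self]; exact Set.projIcc_of_right_le _ h)⟩
      · exact ⟨j, by rwa [Function.update_of_ne hj]⟩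
    obtain ⟨j, hj⟩ := hy
    by_cases hji : j = i
    · subst hji
      simp only [hK]
      rcases hj with h | h
      · rw [if_pos (by norm_num [h]), hH _ _ (key _ (Or.inl ⟨h, by norm_num [h]⟩))]
      · rw [if_neg (by norm_num [h]), hH' _ _ (key _ (Or.inr (Or.inl ⟨h, by norm_num [h]⟩)))]
    · simp only [hK]
      split_ifs
      · exact hH _ _ (key _ (Or.inr (Or.inr ⟨j, hji, hj⟩)))
      · exact hH' _ _ (key _ (Or.inr (Or.inr ⟨j, hji, hj⟩)))

/-- The image of a loop under a continuous map. -/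
def map {Y : Type*} [TopologicalSpace Y] (f : C(X, Y)) (p : Ω^ N X x) : Ω^ N Y (f x) :=
  ⟨f.comp p.1, fun y hy => congrArg f (p.2 y hy)⟩

theorem Homotopic.map {Y : Type*} [TopologicalSpace Y] (f : C(X, Y)) {p q : Ω^ N X x}
    (h : Homotopic p q) : Homotopic (map f p) (map f q) := by
  obtain ⟨H⟩ := h
  refine ⟨⟨⟨f.comp H.toHomotopy.toContinuousMap, fun y => ?_, fun y => ?_⟩, fun t y hy => ?_⟩⟩
  · exact congrArg f (H.apply_zero y)
  · exact congrArg f (H.apply_one y)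
  · exact congrArg f (H.eq_fst t hy)

theorem map_transAt {Y : Type*} [TopologicalSpace Y] [DecidableEq N] (f : C(X, Y)) (i : N)
    (p q : Ω^ N X x) : map f (transAt i p q) = transAt i (map f p) (map f q) := by
  ext y
  change f (transAt i p q y) = _
  simp only [transAt, coe_copy]
  split_ifs <;> rfl

/-- A free homotopy drags the base point along its track; this track is the path by which the two
induced maps differ. -/
theorem homotopicAlong_map {Y : Type*} [TopologicalSpace Y] {f g : C(X, Y)}
    (H : ContinuousMap.Homotopy f g) (p : Ω^ N X x) :
    HomotopicAlong (H.evalAt x) (map f p) (map g p) := by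
  refine ⟨⟨⟨fun z => H (z.1, p z.2), H.continuous.comp (continuous_fst.prodMk
    (p.1.continuous.comp continuous_snd))⟩, fun y => ?_, fun y => ?_⟩, fun t y hy => ?_⟩
  · exact H.apply_zero _
  · exact H.apply_one _
  · change H (t, p y) = H (t, x)
    rw [GenLoop.boundary p y hy]

end GenLoop

/-! ### Functoriality of homotopy groups and free homotopy equivalences. -/

namespace HomotopyGroup

open scoped unitInterval Topology Topology.Homotopy
open GenLoop

variable {N : Type*} [Nonempty N] [DecidableEq N] {X Y : Type*} [TopologicalSpace X]
  [TopologicalSpace Y]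

/-- The homomorphism of homotopy groups induced by a continuous map. -/
noncomputable def map (f : C(X, Y)) (x : X) : HomotopyGroup N X x →* HomotopyGroup N Y (f x) :=
  MonoidHom.mk' (Quotient.map (GenLoop.map f) fun _ _ h => Homotopic.map f h) (by
    rintro ⟨p⟩ ⟨q⟩
    let i : N := Classical.arbitrary N
    refine (congrArg _ (mul_spec (i := i))).trans (Eq.trans ?_ (mul_spec (i := i)).symm)
    -- The product is represented by the concatenation in reversed order, hence `q` before `p`.
    exact congrArg _ (map_transAt f i q p))

theorem map_comp_apply {Z : Type*} [TopologicalSpace Z] (f : C(X, Y)) (g : C(Y, Z)) (x : X)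
    (a : HomotopyGroup N X x) : map (g.comp f) x a = map g (f x) (map f x a) := by
  induction a using Quotient.inductionOn with
  | h p => rfl

variable [Fintype N]

/-- The action of a path on the homotopy groups at its endpoints. -/
noncomputable def changeBase {x x' : X} (γ : Path x x') :
    HomotopyGroup N X x →* HomotopyGroup N X x' :=
  MonoidHom.mk' (Quotient.map (fun p => (exists_homotopicAlong γ p).choose) fun p p' h =>
      (exists_homotopicAlong γ p).choose_spec.unique (exists_homotopicAlong γ p').choose_spec h)
    (by
      rintro ⟨p⟩ ⟨q⟩
      let i : N := Classical.arbitrary N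
      refine (congrArg _ (mul_spec (i := i))).trans (Eq.trans ?_ (mul_spec (i := i)).symm)
      refine Quotient.sound ?_
      exact (exists_homotopicAlong γ _).choose_spec.unique
        ((exists_homotopicAlong γ q).choose_spec.transAt i
          (exists_homotopicAlong γ p).choose_spec) (Homotopic.refl _))

theorem changeBase_mk {x x' : X} {γ : Path x x'} {p : Ω^ N X x} {q : Ω^ N X x'}
    (h : HomotopicAlong γ p q) :
    changeBase γ (⟦p⟧ : HomotopyGroup N X x) = (⟦q⟧ : HomotopyGroup N X x') :=
  Quotient.sound ((exists_homotopicAlong γ p).choose_spec.unique h (Homotopic.refl _))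

theorem changeBase_symm_changeBase {x x' : X} (γ : Path x x') (a : HomotopyGroup N X x) :
    changeBase γ.symm (changeBase γ a) = a := by
  induction a using Quotient.inductionOn with
  | h p =>
    obtain ⟨q, hq⟩ := exists_homotopicAlong γ p
    rw [changeBase_mk hq, changeBase_mk hq.symm]

/-- A path induces an isomorphism between the homotopy groups at its endpoints. -/
noncomputable def changeBaseEquiv {x x' : X} (γ : Path x x') :
    HomotopyGroup N X x ≃* HomotopyGroup N X x' where
  toFun := changeBase γ
  invFun := changeBase γ.symm
  left_inv := changeBase_symm_changeBase γ
  right_inv a := by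
    have := changeBase_symm_changeBase γ.symm a
    rwa [Path.symm_symm] at this
  map_mul' := map_mul _

theorem changeBase_map {f g : C(X, Y)} (H : ContinuousMap.Homotopy f g) (x : X)
    (a : HomotopyGroup N X x) : changeBase (H.evalAt x) (map f x a) = map g x a := by
  induction a using Quotient.inductionOn with
  | h p => exact changeBase_mk (homotopicAlong_map H p)

/-- Followed by transport along the track of the base point, the induced map becomes the identity,
and transport is bijective. -/
theorem map_bijective_of_homotopic_id {f : C(X, X)} (h : f.Homotopic (ContinuousMap.id X))
    (x : X) : Function.Bijective (map (N := N) f x) := by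
  obtain ⟨H⟩ := h
  have hid : ∀ a : HomotopyGroup N X x, map (ContinuousMap.id X) x a = a := by
    rintro ⟨p⟩; rfl
  have h1 : (changeBaseEquiv (N := N) (H.evalAt x)) ∘ map (N := N) f x = id :=
    funext fun a => (changeBase_map H x a).trans (hid a)
  have h2 : Function.Bijective ((changeBaseEquiv (N := N) (H.evalAt x)) ∘ map (N := N) f x) :=
    h1 ▸ Function.bijective_id
  exact (Function.Bijective.of_comp_iff' (changeBaseEquiv (N := N) (H.evalAt x)).bijective _).1 h2

/-- A homotopy equivalence induces isomorphisms of homotopy groups. -/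
theorem map_bijective {f : C(X, Y)} {g : C(Y, X)} (hgf : (g.comp f).Homotopic (.id X))
    (hfg : (f.comp g).Homotopic (.id Y)) (x : X) : Function.Bijective (map (N := N) f x) := by
  have h1 : Function.Bijective (map (N := N) g (f x) ∘ map (N := N) f x) := by
    have := map_bijective_of_homotopic_id (N := N) hgf x
    rwa [show ⇑(map (N := N) (g.comp f) x) = _ from funext (map_comp_apply f g x)] at this
  have h2 : Function.Bijective (map (N := N) f (g (f x)) ∘ map (N := N) g (f x)) := by
    have := map_bijective_of_homotopic_id (N := N) hfg (f x)
    rwa [show ⇑(map (N := N) (f.comp g) (f x)) = _ from funext (map_comp_apply g f (f x))] at this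
  -- The two maps induced by `f` have different base points, so neither composite alone exhibits an
  -- inverse. The middle factor is surjective by the first composite and injective by the second.
  have hg : Function.Bijective (map (N := N) g (f x)) := ⟨h2.1.of_comp, h1.2.of_comp⟩
  exact (Function.Bijective.of_comp_iff' hg _).1 h1

/-- The homotopy groups of homotopy equivalent spaces are isomorphic, at base points that
correspond to each other up to a path. -/
theorem nonempty_mulEquiv {f : C(X, Y)} {g : C(Y, X)} (hgf : (g.comp f).Homotopic (.id X))
    (hfg : (f.comp g).Homotopic (.id Y)) {x : X} {y : Y} (h : Joined (f x) y) :
    Nonempty (HomotopyGroup N X x ≃* HomotopyGroup N Y y) :=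
  ⟨(MulEquiv.ofBijective (map f x) (map_bijective hgf hfg x)).trans
    (changeBaseEquiv h.somePath)⟩

end HomotopyGroup

/-! ### Maps out of a geometric realization, defined simplex by simplex. -/

namespace Gajer

section Realization

variable {K K' : SSet.{u}}

/-- The characteristic map of a simplex, from the standard topological simplex to the geometric
realization. -/
noncomputable def cell {k : SimplexCategory} (σ : K.obj (op k)) :
    C(stdSimplex ℝ (Fin (k.len + 1)), SSet.toTop.obj K) :=
  (SSet.toTop.map (SSet.yonedaEquiv.symm σ)).hom.comp k.toTopHomeo.symm

theorem map_cell (g : K ⟶ K') {k : SimplexCategory} (σ : K.obj (op k))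
    (z : stdSimplex ℝ (Fin (k.len + 1))) :
    SSet.toTop.map g (cell σ z) = cell (g.app (op k) σ) z := by
  have h : SSet.yonedaEquiv.symm σ ≫ g = SSet.yonedaEquiv.symm (g.app (op k) σ) := by
    apply SSet.yonedaEquiv.injective
    simp
  change (SSet.toTop.map (SSet.yonedaEquiv.symm σ) ≫ SSet.toTop.map g) _ = _
  rw [← Functor.map_comp, h]
  rfl

/-- These are the gluing relations of the realization; they follow from naturality of the Yoneda
bijection and of the identification of the realized standard simplex. -/
theorem cell_map {k l : SimplexCategory} (f : k ⟶ l) (σ : K.obj (op l))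
    (z : stdSimplex ℝ (Fin (k.len + 1))) :
    cell (K.map f.op σ) z = cell σ (stdSimplex.map f z) := by
  have h : SSet.yonedaEquiv.symm (K.map f.op σ) =
      SSet.stdSimplex.map f ≫ SSet.yonedaEquiv.symm σ := by
    exact (SSet.yonedaEquiv_symm_naturality_left f σ).symm
  change SSet.toTop.map (SSet.yonedaEquiv.symm (K.map f.op σ)) (k.toTopHomeo.symm z) =
    SSet.toTop.map (SSet.yonedaEquiv.symm σ) (l.toTopHomeo.symm (stdSimplex.map f z))
  rw [h, Functor.map_comp, SimplexCategory.toTopHomeo_symm_naturality_apply]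
  rfl

/-- Reads the adjunction between realization and singular simplices on points. The uniqueness and
the existence of maps prescribed on cells both rest on it. -/
theorem homEquiv_apply_eq_cell {Y : Type u} [TopologicalSpace Y]
    (F : SSet.toTop.obj K ⟶ TopCat.of Y) {k : SimplexCategory} (σ : K.obj (op k))
    (z : stdSimplex ℝ (Fin (k.len + 1))) :
    TopCat.toSSetObjEquiv _ _ ((sSetTopAdj.homEquiv _ _ F).app (op k) σ) z = F (cell σ z) := by
  rw [Adjunction.homEquiv_unit]
  change F.hom ((((sSetTopAdj.unit.app K).app (op k)) σ).down.hom (ULift.up z)) = _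
  rw [sSetTopAdj_unit_app_app_down]
  rfl

/-- A continuous map out of a geometric realization is determined by its values on simplices. -/
theorem realization_hom_ext {Y : Type u} [TopologicalSpace Y]
    {F F' : C(SSet.toTop.obj K, Y)}
    (h : ∀ (k : SimplexCategory) (σ : K.obj (op k)) (z : stdSimplex ℝ (Fin (k.len + 1))), F (cell σ z) = F' (cell σ z)) :
    F = F' := by
  have : (TopCat.ofHom F : SSet.toTop.obj K ⟶ TopCat.of Y) = TopCat.ofHom F' := by
    apply (sSetTopAdj.homEquiv _ _).injective
    ext k σ
    induction k using Opposite.rec with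
    | op k =>
      apply (TopCat.toSSetObjEquiv _ _).injective
      ext z
      exact (homEquiv_apply_eq_cell _ σ z).trans ((h k σ z).trans (homEquiv_apply_eq_cell _ σ z).symm)
  exact congrArg TopCat.Hom.hom this

/-- A compatible family of maps on the simplices defines a map on the geometric realization. -/
theorem exists_realization_desc {Y : Type u} [TopologicalSpace Y]
    (G : ∀ k : SimplexCategory, K.obj (op k) → C(stdSimplex ℝ (Fin (k.len + 1)), Y))
    (hG : ∀ (k l : SimplexCategory) (f : k ⟶ l) (σ : K.obj (op l)) (z : stdSimplex ℝ (Fin (k.len + 1))),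
      G k (K.map f.op σ) z = G l σ (stdSimplex.map f z)) :
    ∃ F : C(SSet.toTop.obj K, Y), ∀ (k : SimplexCategory) (σ : K.obj (op k)) (z : stdSimplex ℝ (Fin (k.len + 1))),
      F (cell σ z) = G k σ z := by
  let α : K ⟶ TopCat.toSSet.obj (TopCat.of Y) :=
    { app := fun k => TypeCat.ofHom fun σ =>
        (TopCat.toSSetObjEquiv (TopCat.of Y) k).symm (G k.unop σ)
      naturality := by
        intro k l f
        ext σ
        apply (TopCat.toSSetObjEquiv _ _).injective
        ext z
        exact hG l.unop k.unop f.unop σ z }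
  refine ⟨((sSetTopAdj.homEquiv _ (TopCat.of Y)).symm α).hom, fun k σ z => ?_⟩
  have h := homEquiv_apply_eq_cell ((sSetTopAdj.homEquiv _ (TopCat.of Y)).symm α) σ z
  rw [Equiv.apply_symm_apply] at h
  exact h.symm

theorem joined_cell {k : SimplexCategory} (σ : K.obj (op k)) (z w : stdSimplex ℝ (Fin (k.len + 1))) :
    Joined (cell σ z) (cell σ w) :=
  ((PathConnectedSpace.joined z w).map (cell σ).continuous)

end Realization

end Gajer

/-! ### The join of a standard simplex with itself. -/

section Join

namespace stdSimplex

/-- The fold map of the vertices of a join `Δ * Δ`. -/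
def fold {a : ℕ} : Fin (a + a) → Fin a := Fin.addCases id id

/-- The vertex map of the projection of a join `Δ * Δ` to the interval. -/
def side {a : ℕ} : Fin (a + a) → Fin 2 := Fin.addCases (fun _ => 0) (fun _ => 1)

/-- The vertex map of the join of a map with itself. -/
def double {a b : ℕ} (f : Fin a → Fin b) : Fin (a + a) → Fin (b + b) :=
  Fin.addCases (fun i => Fin.castAdd b (f i)) (fun i => Fin.natAdd b (f i))

theorem fold_castAdd {a : ℕ} (i : Fin a) : fold (Fin.castAdd a i) = i := by
  simp only [fold, Fin.addCases_left, id]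

theorem fold_natAdd {a : ℕ} (i : Fin a) : fold (Fin.natAdd a i) = i := by
  simp only [fold, Fin.addCases_right, id]

theorem side_castAdd {a : ℕ} (i : Fin a) : side (Fin.castAdd a i) = 0 := by
  simp only [side, Fin.addCases_left]

theorem side_natAdd {a : ℕ} (i : Fin a) : side (Fin.natAdd a i) = 1 := by
  simp only [side, Fin.addCases_right]

theorem double_castAdd {a b : ℕ} (f : Fin a → Fin b) (i : Fin a) :
    double f (Fin.castAdd a i) = Fin.castAdd b (f i) := by
  simp only [double, Fin.addCases_left]

theorem double_natAdd {a b : ℕ} (f : Fin a → Fin b) (i : Fin a) :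
    double f (Fin.natAdd a i) = Fin.natAdd b (f i) := by
  simp only [double, Fin.addCases_right]

/-- All left vertices of the join precede all right ones. Monotonicity makes `double f` a simplicial
operator; `fold` is not one in general. -/
theorem monotone_double {a b : ℕ} {f : Fin a → Fin b} (hf : Monotone f) :
    Monotone (double f) := by
  intro i j hij
  induction i using Fin.addCases with
  | left i =>
    induction j using Fin.addCases with
    | left j =>
      simp only [double, Fin.addCases_left]
      exact hf (show i ≤ j from hij)
    | right j =>
      simp only [double, Fin.addCases_left, Fin.addCases_right, Fin.le_def, Fin.val_castAdd,
        Fin.val_natAdd]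
      omega
  | right i =>
    induction j using Fin.addCases with
    | left j =>
      simp only [Fin.le_def, Fin.val_castAdd, Fin.val_natAdd] at hij
      omega
    | right j =>
      rw [double_natAdd, double_natAdd]
      rw [Fin.le_def, Fin.val_natAdd, Fin.val_natAdd] at hij ⊢
      have h : i ≤ j := Fin.le_def.2 (by omega)
      have := Fin.le_def.1 (hf h)
      omega

/-- The point `(1 - t) z + t z` of the join `Δ * Δ`. -/
noncomputable def joinPoint {a : ℕ} (q : stdSimplex ℝ (Fin a) × unitInterval) :
    stdSimplex ℝ (Fin (a + a)) :=
  ⟨(1 - (q.2 : ℝ)) • (stdSimplex.map (Fin.castAdd a) q.1 : stdSimplex ℝ (Fin (a + a))).1 +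
      (q.2 : ℝ) • (stdSimplex.map (Fin.natAdd a) q.1 : stdSimplex ℝ (Fin (a + a))).1,
    convex_stdSimplex ℝ _ (stdSimplex.map _ q.1).2 (stdSimplex.map _ q.1).2
      (by linarith [q.2.2.2]) q.2.2.1 (by ring)⟩

theorem continuous_joinPoint {a : ℕ} :
    Continuous (joinPoint : stdSimplex ℝ (Fin a) × unitInterval → stdSimplex ℝ (Fin (a + a))) := by
  refine Continuous.subtype_mk ?_ _
  have h1 := continuous_subtype_val.comp
    (stdSimplex.continuous_map (S := ℝ) (Fin.castAdd a : Fin a → Fin (a + a)))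
  have h2 := continuous_subtype_val.comp
    (stdSimplex.continuous_map (S := ℝ) (Fin.natAdd a : Fin a → Fin (a + a)))
  exact ((continuous_const.sub (continuous_subtype_val.comp continuous_snd)).smul
    (h1.comp continuous_fst)).add ((continuous_subtype_val.comp continuous_snd).smul
    (h2.comp continuous_fst))

theorem joinPoint_zero {a : ℕ} (z : stdSimplex ℝ (Fin a)) :
    joinPoint (z, 0) = stdSimplex.map (Fin.castAdd a) z := by
  apply Subtype.ext
  simp [joinPoint]

theorem joinPoint_one {a : ℕ} (z : stdSimplex ℝ (Fin a)) :
    joinPoint (z, 1) = stdSimplex.map (Fin.natAdd a) z := by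
  apply Subtype.ext
  simp [joinPoint]

/-- Since the segments of the join are natural in the simplex, homotopies defined along them simplex
by simplex will glue. -/
theorem map_double_joinPoint {a b : ℕ} (f : Fin a → Fin b) (z : stdSimplex ℝ (Fin a)) (t : unitInterval) :
    stdSimplex.map (double f) (joinPoint (z, t)) = joinPoint (stdSimplex.map f z, t) := by
  have h1 : double f ∘ Fin.castAdd a = Fin.castAdd b ∘ f := funext (double_castAdd f)
  have h2 : double f ∘ Fin.natAdd a = Fin.natAdd b ∘ f :=
    funext (double_natAdd f)
  apply Subtype.ext
  have e : ∀ (g : Fin a → Fin (a + a)),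
      FunOnFinite.linearMap ℝ ℝ (double f) (stdSimplex.map g z : stdSimplex ℝ (Fin (a + a))).1 =
      (stdSimplex.map (double f ∘ g) z : stdSimplex ℝ (Fin (b + b))).1 := fun g => by
    rw [← stdSimplex.map_comp_apply]
    rfl
  change FunOnFinite.linearMap ℝ ℝ (double f) ((1 - (t : ℝ)) •
    (stdSimplex.map (Fin.castAdd a) z : stdSimplex ℝ (Fin (a + a))).1 +
      (t : ℝ) • (stdSimplex.map (Fin.natAdd a) z : stdSimplex ℝ (Fin (a + a))).1) = _
  rw [map_add, map_smul, map_smul, e, e, h1, h2, ← stdSimplex.map_comp_apply,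
    ← stdSimplex.map_comp_apply]
  rfl

theorem map_const_vertex {a b : ℕ} (i : Fin b) (z : stdSimplex ℝ (Fin a)) :
    stdSimplex.map (fun _ => i) z = stdSimplex.vertex (S := ℝ) i := by
  apply Subtype.ext
  funext j
  change stdSimplex.map (fun _ => i) z j = _
  rw [stdSimplex.map_coe, FunOnFinite.linearMap_apply_apply]
  by_cases h : i = j
  · subst h
    have := stdSimplex.sum_eq_one z
    simp
  · simp [h, Ne.symm h]

end stdSimplex

end Join

/-! ### Gajer spaces: induced maps and homotopies. -/

namespace Gajer

open stdSimplex

section Maps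

variable {X X' : Type u} [TopologicalSpace X] [TopologicalSpace X'] {n n' : ℕ}
  {F : Filtration X n} {F' : Filtration X' n'} {p : F.Perversity} {p' : F'.Perversity}

/-- The underlying singular simplex of a simplex of the Gajer space. -/
noncomputable def gajerSimplex {k : SimplexCategory} (σ : (gajerSpace p : SSet.{u}).obj (op k)) :
    C(stdSimplex ℝ (Fin (k.len + 1)), X) :=
  TopCat.toSSetObjEquiv (TopCat.of X) (op k) σ.1

theorem isFull_gajerSimplex {k : SimplexCategory} (σ : (gajerSpace p : SSet.{u}).obj (op k)) :
    IsFull p (gajerSimplex σ) :=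
  σ.2

/-- A full simplex as a simplex of the Gajer space. -/
noncomputable def toGajer {k : SimplexCategory} (σ : C(stdSimplex ℝ (Fin (k.len + 1)), X))
    (h : IsFull p σ) : (gajerSpace p : SSet.{u}).obj (op k) :=
  ⟨(TopCat.toSSetObjEquiv (TopCat.of X) (op k)).symm σ, h⟩

theorem gajer_ext {k : SimplexCategory} {σ τ : (gajerSpace p : SSet.{u}).obj (op k)}
    (h : ∀ z, gajerSimplex σ z = gajerSimplex τ z) : σ = τ :=
  Subtype.ext ((TopCat.toSSetObjEquiv (TopCat.of X) (op k)).injective (ContinuousMap.ext h))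

/-- The map of Gajer spaces induced by a continuous map that preserves full simplices. -/
noncomputable def gajerMap (f : C(X, X'))
    (hf : ∀ (ℓ : ℕ) (σ : C(stdSimplex ℝ (Fin (ℓ + 1)), X)), IsFull p σ → IsFull p' (f.comp σ)) :
    (gajerSpace p : SSet.{u}) ⟶ (gajerSpace p' : SSet.{u}) where
  app k := TypeCat.ofHom fun σ => toGajer (k := k.unop) (f.comp (gajerSimplex (k := k.unop) σ))
    (hf _ _ (isFull_gajerSimplex (k := k.unop) σ))
  naturality k l g := by
    ext σ
    exact gajer_ext (k := l.unop) fun z => rfl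

/-- The map of realizations of Gajer spaces induced by a map that preserves full simplices. -/
noncomputable def gajerRealizationMap (f : C(X, X'))
    (hf : ∀ (ℓ : ℕ) (σ : C(stdSimplex ℝ (Fin (ℓ + 1)), X)), IsFull p σ → IsFull p' (f.comp σ)) :
    C(SSet.toTop.obj (gajerSpace p : SSet.{u}), SSet.toTop.obj (gajerSpace p' : SSet.{u})) :=
  (SSet.toTop.map (gajerMap f hf)).hom

theorem gajerRealizationMap_cell (f : C(X, X'))
    (hf : ∀ (ℓ : ℕ) (σ : C(stdSimplex ℝ (Fin (ℓ + 1)), X)), IsFull p σ → IsFull p' (f.comp σ))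
    {k : SimplexCategory} (σ : (gajerSpace p : SSet.{u}).obj (op k)) (z) :
    gajerRealizationMap f hf (cell σ z) =
      cell (toGajer (f.comp (gajerSimplex σ)) (hf _ _ (isFull_gajerSimplex σ))) z :=
  map_cell _ _ _

/-- The map at time `t` of a homotopy `h`. -/
def atTime (h : C(X × unitInterval, X')) (t : unitInterval) : C(X, X') := ⟨fun x => h (x, t), by fun_prop⟩

/-- The homotopy `h` preserves full simplices, whatever the time coordinate. -/
def PreservesFull (p : F.Perversity) (p' : F'.Perversity) (h : C(X × unitInterval, X')) : Prop :=
  ∀ (ℓ : ℕ) (σ : C(stdSimplex ℝ (Fin (ℓ + 1)), X)) (e : C(stdSimplex ℝ (Fin (ℓ + 1)), unitInterval)),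
    IsFull p σ → IsFull p' (h.comp (σ.prodMk e))

theorem PreservesFull.atTime {h : C(X × unitInterval, X')} (hh : PreservesFull p p' h) (t : unitInterval) (ℓ : ℕ)
    (σ : C(stdSimplex ℝ (Fin (ℓ + 1)), X)) (hσ : IsFull p σ) :
    IsFull p' ((Gajer.atTime h t).comp σ) :=
  hh ℓ σ (ContinuousMap.const _ t) hσ

/-- The projection of a join to the interval. -/
noncomputable def joinTime (a : ℕ) : C(stdSimplex ℝ (Fin (a + a)), unitInterval) :=
  ⟨fun w => stdSimplexHomeomorphUnitInterval (stdSimplex.map side w),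
    stdSimplexHomeomorphUnitInterval.continuous.comp (stdSimplex.continuous_map _)⟩

/-- The simplex `Δ * Δ → Δ × I → X × I → Y` given by a simplex `Δ → X` and a homotopy `X × I → Y`. -/
noncomputable def joinSimplex (h : C(X × unitInterval, X')) {a : ℕ} (σ : C(stdSimplex ℝ (Fin a), X)) :
    C(stdSimplex ℝ (Fin (a + a)), X') :=
  h.comp ((σ.comp ⟨stdSimplex.map fold, stdSimplex.continuous_map _⟩).prodMk (joinTime a))

theorem joinSimplex_map_castAdd (h : C(X × unitInterval, X')) {a : ℕ} (σ : C(stdSimplex ℝ (Fin a), X))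
    (z : stdSimplex ℝ (Fin a)) :
    joinSimplex h σ (stdSimplex.map (Fin.castAdd a) z) = h (σ z, 0) := by
  change h (σ (stdSimplex.map fold (stdSimplex.map (Fin.castAdd a) z)),
    stdSimplexHomeomorphUnitInterval (stdSimplex.map side (stdSimplex.map (Fin.castAdd a) z))) = _
  have h1 : (fold ∘ Fin.castAdd a : Fin a → Fin a) = id := funext fold_castAdd
  have h2 : (side ∘ Fin.castAdd a : Fin a → Fin 2) = fun _ => 0 := funext side_castAdd
  rw [stdSimplex.map_comp_apply, stdSimplex.map_comp_apply, h1, h2, stdSimplex.map_id_apply,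
    map_const_vertex, stdSimplexHomeomorphUnitInterval_zero]

theorem joinSimplex_map_natAdd (h : C(X × unitInterval, X')) {a : ℕ} (σ : C(stdSimplex ℝ (Fin a), X))
    (z : stdSimplex ℝ (Fin a)) :
    joinSimplex h σ (stdSimplex.map (Fin.natAdd a) z) = h (σ z, 1) := by
  change h (σ (stdSimplex.map fold (stdSimplex.map (Fin.natAdd a) z)),
    stdSimplexHomeomorphUnitInterval (stdSimplex.map side (stdSimplex.map (Fin.natAdd a) z))) = _
  have h1 : (fold ∘ Fin.natAdd a : Fin a → Fin a) = id := funext fold_natAdd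
  have h2 : (side ∘ Fin.natAdd a : Fin a → Fin 2) = fun _ => 1 :=
    funext side_natAdd
  rw [stdSimplex.map_comp_apply, stdSimplex.map_comp_apply, h1, h2, stdSimplex.map_id_apply,
    map_const_vertex, stdSimplexHomeomorphUnitInterval_one]

theorem joinSimplex_map_double (h : C(X × unitInterval, X')) {a b : ℕ} (σ : C(stdSimplex ℝ (Fin b), X))
    (f : Fin a → Fin b) (w : stdSimplex ℝ (Fin (a + a))) :
    joinSimplex h (σ.comp ⟨stdSimplex.map f, stdSimplex.continuous_map _⟩) w =
      joinSimplex h σ (stdSimplex.map (double f) w) := by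
  change h (σ (stdSimplex.map f (stdSimplex.map fold w)),
      stdSimplexHomeomorphUnitInterval (stdSimplex.map side w)) =
    h (σ (stdSimplex.map fold (stdSimplex.map (double f) w)),
      stdSimplexHomeomorphUnitInterval (stdSimplex.map side (stdSimplex.map (double f) w)))
  have h1 : (fold ∘ double f : Fin (a + a) → Fin b) = f ∘ fold := by
    funext i
    induction i using Fin.addCases <;> simp only [Function.comp_apply, fold_castAdd, fold_natAdd, double_castAdd,
      double_natAdd]
  have h2 : (side ∘ double f : Fin (a + a) → Fin 2) = side := by
    funext i
    induction i using Fin.addCases <;> simp only [Function.comp_apply, side_castAdd, side_natAdd, double_castAdd,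
      double_natAdd]
  rw [stdSimplex.map_comp_apply, stdSimplex.map_comp_apply, stdSimplex.map_comp_apply, h1, h2]

/-- The join of a simplex with itself. -/
abbrev doubleObj (k : SimplexCategory) : SimplexCategory := ⦋k.len + 1 + k.len⦌

/-- The join simplex is the homotopy applied to the folded simplex and a time function. Folding
preserves fullness although it is not monotone, as any vertex map does. -/
theorem PreservesFull.isFull_joinSimplex {h : C(X × unitInterval, X')} (hh : PreservesFull p p' h)
    {k : SimplexCategory} {σ : C(stdSimplex ℝ (Fin (k.len + 1)), X)} (hσ : IsFull p σ) :
    IsFull (ℓ := (doubleObj k).len) p' (joinSimplex h σ) :=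
  -- With the dimension written in this way, its successor is `(k.len + 1) + (k.len + 1)` by
  -- definition.
  hh (k.len + 1 + k.len) _ (joinTime (k.len + 1))
    (hσ.comp_monotone (a := k.len + 1 + k.len) (fold (a := k.len + 1)))

/-- Homotopies that preserve full simplices induce homotopies on realizations. -/
theorem PreservesFull.homotopic {h : C(X × unitInterval, X')} (hh : PreservesFull p p' h) :
    (gajerRealizationMap (Gajer.atTime h 0) (hh.atTime 0)).Homotopic
      (gajerRealizationMap (Gajer.atTime h 1) (hh.atTime 1)) := by
  -- The track of a point of a cell is a segment inside the single cell of `T k σ`, so no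
  -- subdivision of the prism is needed.
  let T : ∀ k : SimplexCategory, (gajerSpace p : SSet.{u}).obj (op k) →
      (gajerSpace p' : SSet.{u}).obj (op (doubleObj k)) := fun k σ =>
    toGajer (k := doubleObj k) (joinSimplex h (gajerSimplex σ))
      (hh.isFull_joinSimplex (isFull_gajerSimplex σ))
  let inl : ∀ k : SimplexCategory, k ⟶ doubleObj k := fun k => SimplexCategory.Hom.mk
    ⟨Fin.castAdd (k.len + 1), fun i j hij => hij⟩
  let inr : ∀ k : SimplexCategory, k ⟶ doubleObj k := fun k => SimplexCategory.Hom.mk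
    ⟨Fin.natAdd (k.len + 1), fun i j hij => by
      rw [Fin.le_def] at hij ⊢; exact Nat.add_le_add_left hij _⟩
  let dbl : ∀ {k l : SimplexCategory} (f : k ⟶ l), doubleObj k ⟶ doubleObj l := fun f =>
    SimplexCategory.Hom.mk ⟨double f, monotone_double f.toOrderHom.monotone⟩
  have hT0 : ∀ (k : SimplexCategory) (σ : (gajerSpace p : SSet.{u}).obj (op k)) z,
      cell (T k σ) (joinPoint (z, 0)) = gajerRealizationMap _ (hh.atTime 0) (cell σ z) := by
    intro k σ z
    rw [joinPoint_zero, gajerRealizationMap_cell]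
    refine (cell_map (inl k) (T k σ) z).symm.trans ?_
    congr 1
    congr 1
    exact gajer_ext fun w => joinSimplex_map_castAdd h _ w
  have hT1 : ∀ (k : SimplexCategory) (σ : (gajerSpace p : SSet.{u}).obj (op k)) z,
      cell (T k σ) (joinPoint (z, 1)) = gajerRealizationMap _ (hh.atTime 1) (cell σ z) := by
    intro k σ z
    rw [joinPoint_one, gajerRealizationMap_cell]
    refine (cell_map (inr k) (T k σ) z).symm.trans ?_
    congr 1
    congr 1
    exact gajer_ext fun w => joinSimplex_map_natAdd h _ w
  -- The homotopy is curried: a map from the realization to the path space can be prescribed on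
  -- cells, whereas a product with the interval would first have to be realized. Uncurrying is
  -- continuous because the interval is locally compact.
  let G : ∀ k : SimplexCategory, (gajerSpace p : SSet.{u}).obj (op k) →
      C(stdSimplex ℝ (Fin (k.len + 1)), C(unitInterval, SSet.toTop.obj (gajerSpace p' : SSet.{u}))) :=
    fun k σ => ((cell (T k σ)).comp ⟨joinPoint, continuous_joinPoint⟩).curry
  obtain ⟨Φ, hΦ⟩ := exists_realization_desc G (by
    intro k l f σ z
    ext t
    change cell (T k _) (joinPoint (z, t)) = cell (T l σ) (joinPoint (stdSimplex.map f z, t))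
    rw [← map_double_joinPoint]
    refine Eq.trans ?_ (cell_map (dbl f) (T l σ) (joinPoint (z, t)))
    congr 1
    congr 1
    exact gajer_ext fun w => joinSimplex_map_double h (gajerSimplex σ) f w)
  refine ⟨⟨⟨fun q => Φ q.2 q.1, by fun_prop⟩, fun x => ?_, fun x => ?_⟩⟩
  · have : (⟨fun x => Φ x 0, by fun_prop⟩ : C(_, _)) =
        gajerRealizationMap (Gajer.atTime h 0) (hh.atTime 0) :=
      realization_hom_ext fun k σ z => by
        change Φ (cell σ z) 0 = _
        rw [hΦ, ← hT0]
        rfl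
    exact DFunLike.congr_fun this x
  · have : (⟨fun x => Φ x 1, by fun_prop⟩ : C(_, _)) =
        gajerRealizationMap (Gajer.atTime h 1) (hh.atTime 1) :=
      realization_hom_ext fun k σ z => by
        change Φ (cell σ z) 1 = _
        rw [hΦ, ← hT1]
        rfl
    exact DFunLike.congr_fun this x

end Maps

section Points

variable {X X' : Type u} [TopologicalSpace X] [TopologicalSpace X'] {n n' : ℕ}
  {F : Filtration X n} {F' : Filtration X' n'} {p : F.Perversity} {p' : F'.Perversity}

theorem realizationPoint_eq_cell (K : SSet.{u}) (v : K _⦋0⦌) :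
    realizationPoint K v = cell (k := ⦋0⦌) v default := by
  refine congrArg (SSet.toTop.map (SSet.yonedaEquiv.symm v)) ?_
  exact Subsingleton.elim _ _

theorem gajerRealizationMap_realizationPoint (f : C(X, X'))
    (hf : ∀ (ℓ : ℕ) (σ : C(stdSimplex ℝ (Fin (ℓ + 1)), X)), IsFull p σ → IsFull p' (f.comp σ))
    {x : X} (hx : x ∉ F.skel (n - 1)) (hfx : f x ∉ F'.skel (n' - 1)) :
    gajerRealizationMap f hf (realizationPoint _ (gajerVertex p x hx)) =
      realizationPoint _ (gajerVertex p' (f x) hfx) := by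
  rw [realizationPoint_eq_cell, realizationPoint_eq_cell]
  refine (gajerRealizationMap_cell f hf (k := ⦋0⦌) _ _).trans ?_
  congr 1

/-- A path of regular points gives a path in the realization of the Gajer space. -/
theorem joined_realizationPoint (p : F.Perversity) {x y : X} (hx : x ∉ F.skel (n - 1))
    (hy : y ∉ F.skel (n - 1)) (h : JoinedIn (F.skel (n - 1))ᶜ x y) :
    Joined (realizationPoint _ (gajerVertex p x hx))
      (realizationPoint _ (gajerVertex p y hy)) := by
  obtain ⟨γ, hγ⟩ := h
  let σ : C(stdSimplex ℝ (Fin (1 + 1)), X) := γ.toContinuousMap.comp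
    ⟨stdSimplexHomeomorphUnitInterval, stdSimplexHomeomorphUnitInterval.continuous⟩
  have hσ : IsFull p σ := isFull_of_regular p fun z => hγ _
  let s : (gajerSpace p : SSet.{u}).obj (op ⦋1⦌) := toGajer (k := ⦋1⦌) σ hσ
  have key : ∀ (i : Fin 2) (w : X) (hw : w ∉ F.skel (n - 1)), σ (stdSimplex.vertex i) = w →
      realizationPoint _ (gajerVertex p w hw) = cell s (stdSimplex.vertex i) := by
    intro i w hw hi
    rw [realizationPoint_eq_cell]
    let f : ⦋0⦌ ⟶ ⦋1⦌ := SimplexCategory.const ⦋0⦌ ⦋1⦌ i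
    have h1 := cell_map f s default
    rw [show stdSimplex.map f (default : stdSimplex ℝ (Fin (⦋0⦌.len + 1))) = stdSimplex.vertex i
      from map_const_vertex i _] at h1
    rw [← h1]
    congr 1
    refine congrArg _ (gajer_ext (k := ⦋0⦌) fun z => ?_)
    change w = σ (stdSimplex.map (fun _ => i) z)
    rw [map_const_vertex, hi]
  rw [key 0 x hx, key 1 y hy]
  · exact joined_cell s _ _
  · change γ (stdSimplexHomeomorphUnitInterval (stdSimplex.vertex 1)) = y
    rw [stdSimplexHomeomorphUnitInterval_one, γ.target]
  · change γ (stdSimplexHomeomorphUnitInterval (stdSimplex.vertex 0)) = x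
    rw [stdSimplexHomeomorphUnitInterval_zero, γ.source]

/-- The homotopy of realizations comes from `h`; its two ends are recognized by comparing their
values on cells. -/
theorem comp_gajerRealizationMap_homotopic_id {f : C(X, X')} {g : C(X', X)}
    (hf : ∀ (ℓ : ℕ) (σ : C(stdSimplex ℝ (Fin (ℓ + 1)), X)), IsFull p σ → IsFull p' (f.comp σ))
    (hg : ∀ (ℓ : ℕ) (σ : C(stdSimplex ℝ (Fin (ℓ + 1)), X')), IsFull p' σ → IsFull p (g.comp σ))
    {h : C(X × unitInterval, X)} (hh : PreservesFull p p h) (h0 : ∀ x, h (x, 0) = x)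
    (h1 : ∀ x, h (x, 1) = g (f x)) :
    ((gajerRealizationMap g hg).comp (gajerRealizationMap f hf)).Homotopic
      (ContinuousMap.id _) := by
  have e0 : gajerRealizationMap (Gajer.atTime h 0) (hh.atTime 0) = ContinuousMap.id _ := by
    refine realization_hom_ext fun k σ z => ?_
    rw [gajerRealizationMap_cell]
    change cell _ z = cell σ z
    congr 1
    refine congrArg _ (gajer_ext fun w => ?_)
    exact h0 _
  have e1 : gajerRealizationMap (Gajer.atTime h 1) (hh.atTime 1) =
      (gajerRealizationMap g hg).comp (gajerRealizationMap f hf) := by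
    refine realization_hom_ext fun k σ z => ?_
    rw [ContinuousMap.comp_apply, gajerRealizationMap_cell, gajerRealizationMap_cell,
      gajerRealizationMap_cell]
    congr 1
    refine congrArg _ (gajer_ext fun w => ?_)
    exact h1 _
  rw [← e0, ← e1]
  exact hh.homotopic.symm

/-- Homotopy equivalences that preserve full simplices induce isomorphisms of intersection
homotopy groups. -/
theorem nonempty_mulEquiv_of_preservesFull {f : C(X, X')} {g : C(X', X)} {h : C(X × unitInterval, X)}
    {h' : C(X' × unitInterval, X')}
    (hf : ∀ (ℓ : ℕ) (σ : C(stdSimplex ℝ (Fin (ℓ + 1)), X)), IsFull p σ → IsFull p' (f.comp σ))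
    (hg : ∀ (ℓ : ℕ) (σ : C(stdSimplex ℝ (Fin (ℓ + 1)), X')), IsFull p' σ → IsFull p (g.comp σ))
    (hh : PreservesFull p p h) (h0 : ∀ x, h (x, 0) = x) (h1 : ∀ x, h (x, 1) = g (f x))
    (hh' : PreservesFull p' p' h') (h0' : ∀ x, h' (x, 0) = x) (h1' : ∀ x, h' (x, 1) = f (g x))
    {x : X} {y : X'} (hx : x ∉ F.skel (n - 1)) (hy : y ∉ F'.skel (n' - 1))
    (hj : JoinedIn (F'.skel (n' - 1))ᶜ (f x) y) (ℓ : ℕ) [NeZero ℓ] :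
    Nonempty (IntersectionHomotopyGroup ℓ p x hx ≃* IntersectionHomotopyGroup ℓ p' y hy) := by
  refine HomotopyGroup.nonempty_mulEquiv (comp_gajerRealizationMap_homotopic_id hf hg hh h0 h1)
    (comp_gajerRealizationMap_homotopic_id hg hf hh' h0' h1') ?_
  rw [gajerRealizationMap_realizationPoint f hf hx hj.source_mem]
  exact joined_realizationPoint p' _ _ hj

end Points

end Gajer

/-! ### Dimension bounds, strata and a criterion for fullness. -/

namespace Gajer

open Topology Metric

section Dimension

variable {E : Type*} [NormedAddCommGroup E] [NormedSpace ℝ E]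

theorem IsPolyhedronOfDimLE.mono {k k' : ℕ} (hk : k ≤ k') {Q : Set E}
    (h : IsPolyhedronOfDimLE k Q) : IsPolyhedronOfDimLE k' Q := by
  obtain ⟨T, hT, hQ⟩ := h
  exact ⟨T, fun t ht => ⟨(hT t ht).1, (hT t ht).2.trans (by omega)⟩, hQ⟩

theorem IsPolyhedronOfDimLE.union {k : ℕ} {Q R : Set E} (hQ : IsPolyhedronOfDimLE k Q)
    (hR : IsPolyhedronOfDimLE k R) : IsPolyhedronOfDimLE k (Q ∪ R) := by
  have := IsPolyhedronOfDimLE.biUnion Finset.univ (fun b : Bool => if b then Q else R)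
    (k := k) (by rintro (_ | _) - <;> simpa)
  simpa [Set.union_eq_iUnion, Bool.cond_eq_ite] using this

theorem PolyDimLE.mono {A B : Set E} {d : WithBot (WithTop ℤ)} (h : PolyDimLE B d) (hAB : A ⊆ B) :
    PolyDimLE A d := by
  rcases h with rfl | ⟨k, hk, Q, hQ, hBQ⟩
  · exact Or.inl (Set.subset_empty_iff.1 hAB)
  · exact Or.inr ⟨k, hk, Q, hQ, hAB.trans hBQ⟩

theorem PolyDimLE.union {A B : Set E} {d : WithBot (WithTop ℤ)} (hA : PolyDimLE A d)
    (hB : PolyDimLE B d) : PolyDimLE (A ∪ B) d := by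
  rcases hA with rfl | ⟨k, hk, Q, hQ, hAQ⟩
  · rwa [Set.empty_union]
  rcases hB with rfl | ⟨k', hk', Q', hQ', hBQ'⟩
  · rw [Set.union_empty]
    exact Or.inr ⟨k, hk, Q, hQ, hAQ⟩
  refine Or.inr ⟨max k k', ?_, Q ∪ Q', (hQ.mono (le_max_left _ _)).union
    (hQ'.mono (le_max_right _ _)), Set.union_subset_union hAQ hBQ'⟩
  rcases max_cases k k' with ⟨h, -⟩ | ⟨h, -⟩ <;> rwa [h]

theorem PolyDimLE.biUnion {ι : Type*} {s : Set ι} (hs : s.Finite) {A : ι → Set E}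
    {d : WithBot (WithTop ℤ)} (h : ∀ i ∈ s, PolyDimLE (A i) d) : PolyDimLE (⋃ i ∈ s, A i) d := by
  induction s, hs using Set.Finite.induction_on with
  | empty => exact Or.inl (by simp)
  | insert _ _ ih =>
    rw [Set.biUnion_insert]
    exact (h _ (Set.mem_insert _ _)).union (ih fun i hi => h i (Set.mem_insert_of_mem _ hi))

end Dimension

section Strata

variable {X : Type*} [TopologicalSpace X] {n : ℕ} {F : Filtration X n}

namespace Filtration

theorem piece_unique {x : X} {i j : ℤ} (hi : x ∈ F.piece i) (hj : x ∈ F.piece j) : i = j := by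
  rcases lt_trichotomy i j with h | h | h
  · exact (hj.2 (F.mono (by omega) hi.1)).elim
  · exact h
  · exact (hi.2 (F.mono (by omega) hj.1)).elim

theorem nonneg_of_mem_piece {x : X} {i : ℤ} (hi : x ∈ F.piece i) : 0 ≤ i := by
  by_contra h
  have := hi.1
  rw [F.skel_neg i (by omega)] at this
  exact this

theorem notMem_skel_pred_iff {x : X} : x ∉ F.skel (n - 1) ↔ x ∈ F.piece n := by
  rw [piece, F.skel_top]
  simp

theorem isOpen_piece_top (F : Filtration X n) : IsOpen (F.piece n) := by
  have : F.piece n = (F.skel (n - 1))ᶜ := by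
    ext x; exact notMem_skel_pred_iff.symm
  rw [this]
  exact (F.isClosed _).isOpen_compl

theorem Stratum.eq_of_mem {S T : F.Stratum} {x : X} (hS : x ∈ S.carrier) (hT : x ∈ T.carrier) :
    S = T := by
  have hd := piece_unique (S.carrier_subset hS) (T.carrier_subset hT)
  obtain ⟨i, A, a, ha, rfl⟩ := S
  obtain ⟨j, B, b, hb, rfl⟩ := T
  dsimp only at hd hS hT
  subst hd
  have : connectedComponentIn (F.piece i) a = connectedComponentIn (F.piece i) b :=
    (connectedComponentIn_eq hS).trans (connectedComponentIn_eq hT).symm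
  congr

theorem stratumAt_eq {S : F.Stratum} {x : X} (h : x ∈ S.carrier) : F.stratumAt x = S :=
  Stratum.eq_of_mem (F.mem_stratumAt x) h

theorem stratumAt_dim {x : X} {i : ℤ} (h : x ∈ F.piece i) : (F.stratumAt x).dim = i :=
  piece_unique ((F.stratumAt x).carrier_subset (F.mem_stratumAt x)) h

theorem Stratum.isPreconnected (S : F.Stratum) : IsPreconnected S.carrier := by
  obtain ⟨x, _, h⟩ := S.isComponent
  rw [h]
  exact isPreconnected_connectedComponentIn

/-- The set lies in one connected component of the piece. This is how two points are shown to share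
a stratum throughout. -/
theorem stratumAt_eq_of_isPreconnected {A : Set X} (hA : IsPreconnected A) {i : ℤ}
    (hAi : A ⊆ F.piece i) {a b : X} (ha : a ∈ A) (hb : b ∈ A) : F.stratumAt a = F.stratumAt b := by
  let S : F.Stratum := ⟨i, connectedComponentIn (F.piece i) a, a, hAi ha, rfl⟩
  have hS : A ⊆ S.carrier := hA.subset_connectedComponentIn ha hAi
  rw [stratumAt_eq (hS ha), stratumAt_eq (hS hb)]

theorem codim_ne_zero_iff {S : F.Stratum} : S.IsSingular ↔ S.codim ≠ 0 := by
  unfold Stratum.IsSingular Stratum.codim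
  constructor <;> intro h h' <;> exact h (by omega)

end Filtration

/-- Fullness passes from a simplex `σ` of a space with finitely many strata to a simplex `τ` that
visits, at each point, a stratum of the same codimension and perversity. -/
theorem IsFull.of_label {Y : Type*} [TopologicalSpace Y] {m : ℕ} {G : Filtration Y m}
    {p : F.Perversity} {q : G.Perversity} (hfin : Finite F.Stratum) {ℓ : ℕ}
    {σ : C(stdSimplex ℝ (Fin (ℓ + 1)), X)} (hσ : IsFull p σ)
    {τ : C(stdSimplex ℝ (Fin (ℓ + 1)), Y)}
    (hc : ∀ z, (F.stratumAt (σ z)).codim = (G.stratumAt (τ z)).codim)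
    (hp : ∀ z, p.val (F.stratumAt (σ z)) = q.val (G.stratumAt (τ z))) : IsFull q τ := by
  intro k δ T hT
  -- The preimage of `T` is covered by the preimages under `σ` of the strata that occur there. These
  -- have the codimension and perversity of `T`, and finiteness of their number lets the bounds be
  -- combined.
  let 𝒮 : Set F.Stratum := {S | ∃ z, σ (simplexMap δ z) ∈ S.carrier ∧ τ (simplexMap δ z) ∈ T.carrier}
  refine PolyDimLE.mono (PolyDimLE.biUnion (s := 𝒮) (Set.toFinite _)
    (A := fun S => Subtype.val '' ((σ.comp (simplexMap δ)) ⁻¹' S.carrier)) ?_) ?_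
  · rintro S ⟨z, hzS, hzT⟩
    have hc' := hc (simplexMap δ z)
    have hp' := hp (simplexMap δ z)
    rw [Filtration.stratumAt_eq hzS, Filtration.stratumAt_eq hzT] at hc' hp'
    rw [← hc', ← hp']
    exact hσ k δ S (Filtration.codim_ne_zero_iff.2 (hc' ▸ Filtration.codim_ne_zero_iff.1 hT))
  · rintro _ ⟨z, hz, rfl⟩
    exact Set.mem_biUnion (x := F.stratumAt (σ (simplexMap δ z)))
      ⟨z, F.mem_stratumAt _, hz⟩ ⟨z, F.mem_stratumAt _, rfl⟩

end Strata

/-! ### Connectedness of the trace of an open set on a subset. -/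

section Glueing

variable {X : Type*} [TopologicalSpace X]

/-- An open preconnected set remains preconnected after intersection with a set `D` if all of its
points have arbitrarily small neighborhoods of which the intersections with `D` are nonempty and
preconnected. -/
theorem isPreconnected_inter_of_local {W D : Set X} (hWo : IsOpen W) (hW : IsPreconnected W)
    (h : ∀ x ∈ W, ∀ N ∈ 𝓝 x, ∃ M ∈ 𝓝 x, M ⊆ N ∧ (M ∩ D).Nonempty ∧ IsPreconnected (M ∩ D)) :
    IsPreconnected (W ∩ D) := by
  intro A B hA hB hsub ⟨a, haW, haA⟩ ⟨b, hbW, hbB⟩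
  by_contra hcon
  rw [Set.not_nonempty_iff_eq_empty] at hcon
  -- `loc C` consists of the points of `W` near which `D` lies in `C`. The sets for `A` and `B` are
  -- open and cover `W`; connectedness of `W` gives a common point, near which the nonempty trace of
  -- `D` lies in both.
  let loc : Set X → Set X := fun C => {x | ∀ᶠ z in 𝓝 x, z ∈ W ∧ (z ∈ D → z ∈ C)}
  have hloc : ∀ C, IsOpen (loc C) := fun C => isOpen_setOfPred_eventually_nhds
  have hmem : ∀ C, IsOpen C → ∀ x ∈ W ∩ C, x ∈ loc C := fun C hC x hx => by
    filter_upwards [hWo.mem_nhds hx.1, hC.mem_nhds hx.2] with z h1 h2 using ⟨h1, fun _ => h2⟩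
  have hcov : W ⊆ loc A ∪ loc B := by
    intro x hx
    obtain ⟨M, hM, hMW, -, hMc⟩ := h x hx W (hWo.mem_nhds hx)
    have hMAB : M ∩ D ⊆ A ∪ B := fun z hz => hsub ⟨hMW hz.1, hz.2⟩
    by_cases h1 : (M ∩ D ∩ A).Nonempty
    · by_cases h2 : (M ∩ D ∩ B).Nonempty
      · obtain ⟨z, hz, hzAB⟩ := hMc A B hA hB hMAB h1 h2
        have : z ∈ W ∩ D ∩ (A ∩ B) := ⟨⟨hMW hz.1, hz.2⟩, hzAB⟩
        rw [hcon] at this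
        exact this.elim
      · left
        filter_upwards [hM] with z hz
        refine ⟨hMW hz, fun hzD => (hMAB ⟨hz, hzD⟩).resolve_right fun hzB => h2 ⟨z, ⟨hz, hzD⟩, hzB⟩⟩
    · right
      filter_upwards [hM] with z hz
      refine ⟨hMW hz, fun hzD => (hMAB ⟨hz, hzD⟩).resolve_left fun hzA => h1 ⟨z, ⟨hz, hzD⟩, hzA⟩⟩
  obtain ⟨x, hxW, hxA, hxB⟩ := hW _ _ (hloc A) (hloc B) hcov
    ⟨a, haW.1, hmem A hA a ⟨haW.1, haA⟩⟩ ⟨b, hbW.1, hmem B hB b ⟨hbW.1, hbB⟩⟩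
  obtain ⟨M, -, hM, ⟨z, hzM, hzD⟩, -⟩ := h x hxW _ (Filter.inter_mem hxA hxB)
  obtain ⟨h1, h2⟩ := hM hzM
  have : z ∈ W ∩ D ∩ (A ∩ B) := ⟨⟨h1.1, hzD⟩, h1.2 hzD, h2.2 hzD⟩
  rw [hcon] at this
  exact this

end Glueing

/-! ### Conical coordinates and the labels of points of the link. -/

section Coordinates

/-- Conical coordinates `(v, y, t)` around the point `x` of the piece of dimension `i`: `v` is a
point of the open unit ball, `y` is a point of the link and `0 < t < 1`; the points of the piece of
dimension `i` are parametrized by the unit ball alone. -/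
structure ConeCoords {X : Type*} [TopologicalSpace X] {n : ℕ} (F : Filtration X n) (x : X) (i : ℕ)
    {L : Type*} [TopologicalSpace L] {m : ℕ} (G : Filtration L m) where
  dim_eq : i + m + 1 = n
  compactSpace : CompactSpace L
  isFilteredSpace : G.IsFilteredSpace
  center : EuclideanSpace ℝ (Fin i) → X
  continuousOn_center : ContinuousOn center (ball 0 1)
  center_zero : center 0 = x
  center_mem : ∀ v ∈ ball 0 1, center v ∈ F.piece i
  chart : OpenPartialHomeomorph (EuclideanSpace ℝ (Fin i) × L × ℝ) X
  source_eq : chart.source = ball 0 1 ×ˢ (Set.univ ×ˢ Set.Ioo 0 1)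
  chart_mem : ∀ v ∈ ball 0 1, ∀ t ∈ Set.Ioo (0 : ℝ) 1, ∀ (y : L) (d : ℤ), y ∈ G.piece d →
    chart (v, y, t) ∈ F.piece (i + 1 + d)
  core_mem_nhds : ∀ s ∈ Set.Ioc (0 : ℝ) 1,
    center '' ball 0 s ∪ chart '' (ball 0 s ×ˢ (Set.univ ×ˢ Set.Ioo 0 s)) ∈ 𝓝 x
  exists_core_subset : ∀ N ∈ 𝓝 x, ∃ s ∈ Set.Ioc (0 : ℝ) 1,
    center '' ball 0 s ∪ chart '' (ball 0 s ×ˢ (Set.univ ×ˢ Set.Ioo 0 s)) ⊆ N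

namespace ConeCoords

variable {X : Type*} [TopologicalSpace X] {n : ℕ} {F : Filtration X n} {x : X} {i : ℕ}
  {L : Type*} [TopologicalSpace L] {m : ℕ} {G : Filtration L m} (C : ConeCoords F x i G)

/-- The part of a conical neighborhood off the piece of `x`. -/
def tube (s : ℝ) : Set X := C.chart '' (ball 0 s ×ˢ (Set.univ ×ˢ Set.Ioo 0 s))

/-- The conical neighborhood of size `s`. -/
def core (s : ℝ) : Set X := C.center '' ball 0 s ∪ C.tube s

/-- The projection of the tube to the link. -/
noncomputable def proj (w : X) : L := (C.chart.symm w).2.1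

/-- The copy of the link at height `t`. -/
noncomputable def incl (t : ℝ) (y : L) : X := C.chart (0, y, t)

/-- The stratum of `X` on which a point of the link lies. -/
noncomputable def label (y : L) : F.Stratum := F.stratumAt (C.incl (1 / 2) y)

theorem half_mem : (1 / 2 : ℝ) ∈ Set.Ioo (0 : ℝ) 1 := by norm_num

theorem mem_source {v : EuclideanSpace ℝ (Fin i)} {y : L} {t : ℝ} :
    (v, y, t) ∈ C.chart.source ↔ v ∈ ball 0 1 ∧ t ∈ Set.Ioo (0 : ℝ) 1 := by
  rw [C.source_eq]; simp

theorem prod_subset_source {s : ℝ} (hs : s ≤ 1) :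
    (ball (0 : EuclideanSpace ℝ (Fin i)) s ×ˢ ((Set.univ : Set L) ×ˢ Set.Ioo 0 s)) ⊆
      C.chart.source := by
  rintro ⟨v, y, t⟩ ⟨hv, -, ht⟩
  exact C.mem_source.2 ⟨ball_subset_ball hs hv, ht.1, ht.2.trans_le hs⟩

theorem tube_one : C.tube 1 = C.chart.target := by
  rw [tube, ← C.source_eq, C.chart.image_source_eq_target]

theorem isOpen_tube {s : ℝ} (hs : s ≤ 1) : IsOpen (C.tube s) := by
  refine C.chart.isOpen_image_of_subset_source ?_ (C.prod_subset_source hs)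
  exact isOpen_ball.prod (isOpen_univ.prod isOpen_Ioo)

theorem incl_mem_tube {s t : ℝ} (ht : t ∈ Set.Ioo 0 s) (y : L) : C.incl t y ∈ C.tube s :=
  ⟨(0, y, t), ⟨mem_ball_self (ht.1.trans ht.2), trivial, ht⟩, rfl⟩

theorem continuous_incl {t : ℝ} (ht : t ∈ Set.Ioo (0 : ℝ) 1) : Continuous (C.incl t) :=
  C.chart.continuousOn.comp_continuous (by fun_prop)
    fun _ => C.mem_source.2 ⟨mem_ball_self one_pos, ht⟩

theorem continuousOn_proj : ContinuousOn C.proj C.chart.target :=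
  (continuous_fst.comp continuous_snd).comp_continuousOn C.chart.continuousOn_symm

theorem proj_chart {v : EuclideanSpace ℝ (Fin i)} {y : L} {t : ℝ} (hv : v ∈ ball 0 1)
    (ht : t ∈ Set.Ioo (0 : ℝ) 1) : C.proj (C.chart (v, y, t)) = y := by
  rw [proj, C.chart.left_inv (C.mem_source.2 ⟨hv, ht⟩)]

theorem mem_piece (C : ConeCoords F x i G) : x ∈ F.piece i :=
  C.center_zero ▸ C.center_mem 0 (mem_ball_self one_pos)

/-- With `y` fixed, varying `v` and `t` sweeps out a connected subset of one piece of `X`. Hence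
movements in the ball and height directions never change the stratum. -/
theorem stratumAt_chart {v : EuclideanSpace ℝ (Fin i)} {y : L} {t : ℝ} (hv : v ∈ ball 0 1)
    (ht : t ∈ Set.Ioo (0 : ℝ) 1) : F.stratumAt (C.chart (v, y, t)) = C.label y := by
  obtain ⟨d, hd⟩ := G.exists_mem_piece y
  have hpc : IsPreconnected ((fun q : EuclideanSpace ℝ (Fin i) × ℝ => C.chart (q.1, y, q.2)) ''
      (ball 0 1 ×ˢ Set.Ioo 0 1)) := by
    refine IsPreconnected.image ((convex_ball _ _).isPreconnected.prod isPreconnected_Ioo) _ ?_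
    refine C.chart.continuousOn.comp (by fun_prop) ?_
    rintro ⟨v, t⟩ ⟨hv, ht⟩
    exact C.mem_source.2 ⟨hv, ht⟩
  refine Filtration.stratumAt_eq_of_isPreconnected hpc (i := i + 1 + d) ?_
    ⟨(v, t), ⟨hv, ht⟩, rfl⟩ ⟨(0, 1 / 2), ⟨mem_ball_self one_pos, half_mem⟩, rfl⟩
  rintro _ ⟨⟨v, t⟩, ⟨hv, ht⟩, rfl⟩
  exact C.chart_mem v hv t ht _ d hd

theorem label_dim {y : L} {d : ℤ} (hd : y ∈ G.piece d) : (C.label y).dim = i + 1 + d :=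
  Filtration.stratumAt_dim (C.chart_mem _ (mem_ball_self one_pos) _ half_mem _ _ hd)

/-- The ball adds `i` and the cone adds 1 to both the formal dimension and the dimension of the
stratum. -/
theorem label_codim (y : L) : (C.label y).codim = (G.stratumAt y).codim := by
  obtain ⟨d, hd⟩ := G.exists_mem_piece y
  have h1 := C.dim_eq
  rw [Filtration.Stratum.codim, Filtration.Stratum.codim, C.label_dim hd,
    Filtration.stratumAt_dim hd]
  omega

theorem label_eq_of_mem {T : G.Stratum} {y y' : L} (hy : y ∈ T.carrier) (hy' : y' ∈ T.carrier) :
    C.label y = C.label y' := by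
  refine Filtration.stratumAt_eq_of_isPreconnected (A := C.incl (1 / 2) '' T.carrier)
    (i := i + 1 + T.dim) ?_ ?_ ⟨y, hy, rfl⟩ ⟨y', hy', rfl⟩
  · exact T.isPreconnected.image _ (C.continuous_incl half_mem).continuousOn
  · rintro _ ⟨z, hz, rfl⟩
    exact C.chart_mem _ (mem_ball_self one_pos) _ half_mem _ _ (T.carrier_subset hz)

theorem exists_eq_chart {w : X} (hw : w ∈ C.chart.target) :
    ∃ v ∈ ball 0 1, ∃ t ∈ Set.Ioo (0 : ℝ) 1, w = C.chart (v, C.proj w, t) := by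
  have h := C.chart.map_target hw
  have h' := C.chart.right_inv hw
  rcases hq : C.chart.symm w with ⟨v, y, t⟩
  rw [hq] at h h'
  obtain ⟨hv, ht⟩ := C.mem_source.1 h
  refine ⟨v, hv, t, ht, ?_⟩
  rw [proj, hq, h']

theorem label_proj {w : X} (hw : w ∈ C.chart.target) : C.label (C.proj w) = F.stratumAt w := by
  obtain ⟨v, hv, t, ht, h⟩ := C.exists_eq_chart hw
  rw [← C.stratumAt_chart hv ht, ← h]

theorem proj_mem_piece {w : X} (hw : w ∈ C.chart.target) {d : ℤ} (hd : w ∈ F.piece d) :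
    C.proj w ∈ G.piece (d - i - 1) := by
  obtain ⟨e, he⟩ := G.exists_mem_piece (C.proj w)
  obtain ⟨v, hv, t, ht, h⟩ := C.exists_eq_chart hw
  have h1 := C.chart_mem v hv t ht _ e he
  rw [← h] at h1
  have := Filtration.piece_unique hd h1
  rwa [show d - i - 1 = e by omega]

/-- A piece of the link has nonnegative dimension, and the cone direction adds 1 to it. The
inductions on codimension descend by this inequality, and it keeps the tube off the piece of `x`. -/
theorem lt_of_mem_tube {w : X} (hw : w ∈ C.chart.target) {d : ℤ} (hd : w ∈ F.piece d) : i < d := by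
  have := Filtration.nonneg_of_mem_piece (C.proj_mem_piece hw hd)
  omega

theorem mem_tube_of_mem_core (s : ℝ) {w : X} (hw : w ∈ C.core s) (hs : s ≤ 1)
    (hi : w ∉ F.piece i) : w ∈ C.tube s := by
  rcases hw with ⟨v, hv, rfl⟩ | hw
  · exact (hi (C.center_mem v (ball_subset_ball hs hv))).elim
  · exact hw

theorem tube_mono {s s' : ℝ} (h : s ≤ s') : C.tube s ⊆ C.tube s' := by
  apply Set.image_mono
  rintro ⟨v, y, t⟩ ⟨hv, -, ht⟩
  exact ⟨ball_subset_ball h hv, trivial, ht.1, ht.2.trans_le h⟩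

/-- If all the points off the center have neighborhoods covered by finitely many connected subsets
of pieces, then the link has finitely many strata. -/
theorem finite_stratum
    (h : ∀ w ∈ C.chart.target, ∀ N ∈ 𝓝 w, ∃ 𝒞 : Set (Set X), 𝒞.Finite ∧
      (∀ A ∈ 𝒞, IsPreconnected A ∧ A ⊆ N ∧ ∃ d, A ⊆ F.piece d) ∧ ⋃₀ 𝒞 ∈ 𝓝 w) :
    Finite G.Stratum := by
  have := C.compactSpace
  have hfin : (G.stratumAt '' Set.univ).Finite := by
    refine isCompact_univ.induction_on (p := fun s => (G.stratumAt '' s).Finite) (by simp)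
      (fun s t hst ht => ht.subset (Set.image_mono hst))
      (fun s t hs ht => by rw [Set.image_union]; exact hs.union ht) ?_
    intro y _
    have hy : C.incl (1 / 2) y ∈ C.chart.target :=
      C.tube_one ▸ C.incl_mem_tube half_mem y
    obtain ⟨𝒞, hf, h𝒞, hnhds⟩ := h _ hy _ (C.chart.open_target.mem_nhds hy)
    refine ⟨C.incl (1 / 2) ⁻¹' ⋃₀ 𝒞, nhdsWithin_le_nhds
      ((C.continuous_incl half_mem).continuousAt hnhds), ?_⟩
    refine (Set.Finite.biUnion hf (t := fun A => (fun w => G.stratumAt (C.proj w)) '' A)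
      fun A hA => ?_).subset ?_
    -- A connected subset of one piece of `X` projects to a connected subset of one piece of the
    -- link, hence into a single stratum.
    · obtain ⟨hpc, hsub, d, hd⟩ := h𝒞 A hA
      refine Set.Subsingleton.finite ?_
      rintro _ ⟨a, ha, rfl⟩ _ ⟨b, hb, rfl⟩
      refine Filtration.stratumAt_eq_of_isPreconnected (A := C.proj '' A) (i := d - i - 1)
        (hpc.image _ (C.continuousOn_proj.mono hsub)) ?_ ⟨a, ha, rfl⟩ ⟨b, hb, rfl⟩
      rintro _ ⟨w, hw, rfl⟩
      exact C.proj_mem_piece (hsub hw) (hd hw)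
    · rintro _ ⟨y', ⟨A, hA, hy'⟩, rfl⟩
      refine Set.mem_biUnion hA ⟨_, hy', ?_⟩
      dsimp only
      rw [incl, C.proj_chart (mem_ball_self one_pos) half_mem]
  refine Set.finite_univ_iff.1 (hfin.subset fun T _ => ?_)
  obtain ⟨y, hy⟩ := T.nonempty
  exact ⟨y, trivial, Filtration.stratumAt_eq hy⟩

theorem exists_regular (C : ConeCoords F x i G) : ∃ y : L, y ∈ G.piece m := by
  have h := C.isFilteredSpace
  rw [Filtration.IsFilteredSpace, Ne, Set.eq_univ_iff_forall] at h
  push Not at h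
  obtain ⟨y, hy⟩ := h
  exact ⟨y, Filtration.notMem_skel_pred_iff.1 hy⟩

theorem isPreconnected_tube [PreconnectedSpace L] {s : ℝ} (hs : s ≤ 1) :
    IsPreconnected (C.tube s) := by
  refine IsPreconnected.image ?_ _ (C.chart.continuousOn.mono (C.prod_subset_source hs))
  exact (convex_ball _ _).isPreconnected.prod (isPreconnected_univ.prod isPreconnected_Ioo)

end ConeCoords

end Coordinates

end Gajer

/-! ### Conical coordinates obtained from a conical chart. -/

namespace Gajer

open Topology Metric

section Cone

variable {L : Type*}

namespace OpenCone

theorem mk_zero_eq (y y' : L) : mk y zero = mk y' zero :=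
  Quotient.sound (s := coneSetoid L) (Or.inr ⟨rfl, rfl⟩)

theorem mk_eq_mk_of_pos {y y' : L} {t t' : Set.Ico (0 : ℝ) 1} (ht : 0 < (t : ℝ))
    (h : mk y t = mk y' t') : y = y' ∧ t = t' := by
  rcases Quotient.exact h with h | h
  · exact Prod.mk.inj h
  · exact absurd h.1 ht.ne'

variable [TopologicalSpace L]

theorem continuous_mk : Continuous fun q : L × Set.Ico (0 : ℝ) 1 => mk q.1 q.2 :=
  continuous_quotient_mk'

/-- Off the zero level the equivalence classes are points, so open sets at positive height are
saturated and have open images. -/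
theorem map_mk_nhds (y : L) {t : Set.Ico (0 : ℝ) 1} (ht : 0 < (t : ℝ)) :
    Filter.map (fun q : L × Set.Ico (0 : ℝ) 1 => mk q.1 q.2) (𝓝 (y, t)) = 𝓝 (mk y t) := by
  refine le_antisymm (continuous_mk.tendsto _) ?_
  intro A hA
  obtain ⟨B, hBA, hB, hyt⟩ := mem_nhds_iff.1 (Filter.mem_map.1 hA)
  have hpos : IsOpen ({q | 0 < (q.2 : ℝ)} : Set (L × Set.Ico (0 : ℝ) 1)) :=
    isOpen_lt continuous_const (by fun_prop)
  have hpre : Quotient.mk (coneSetoid L) ⁻¹' ((fun q : L × Set.Ico (0 : ℝ) 1 => mk q.1 q.2) ''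
      (B ∩ {q | 0 < (q.2 : ℝ)})) = B ∩ {q | 0 < (q.2 : ℝ)} := by
    ext ⟨z, s⟩
    constructor
    · rintro ⟨⟨z', s'⟩, ⟨h1, h2⟩, h⟩
      obtain ⟨rfl, rfl⟩ := mk_eq_mk_of_pos h2 h
      exact ⟨h1, h2⟩
    · exact fun h => ⟨_, h, rfl⟩
  have hopen : IsOpen ((fun q : L × Set.Ico (0 : ℝ) 1 => mk q.1 q.2) ''
      (B ∩ {q | 0 < (q.2 : ℝ)})) :=
    isQuotientMap_quotient_mk'.isOpen_preimage.1 (by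
      have h := hB.inter hpos
      rw [← hpre] at h
      exact h)
  refine Filter.mem_of_superset (hopen.mem_nhds ⟨(y, t), ⟨hyt, ht⟩, rfl⟩) ?_
  rintro _ ⟨q, hq, rfl⟩
  exact hBA hq.1

theorem setOf_lt_mem_nhds (y : L) {s : ℝ} (hs : 0 < s) :
    {q | ∃ (y : L) (t : Set.Ico (0 : ℝ) 1), (t : ℝ) < s ∧ q = mk y t} ∈
      𝓝 (mk y zero) := by
  have hpre : Quotient.mk (coneSetoid L) ⁻¹' {q | ∃ (y : L) (t : Set.Ico (0 : ℝ) 1),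
      (t : ℝ) < s ∧ q = mk y t} =
        ({q | (q.2 : ℝ) < s} : Set (L × Set.Ico (0 : ℝ) 1)) := by
    ext ⟨z, r⟩
    constructor
    · rintro ⟨y', t, h1, h⟩
      rcases Quotient.exact h with h | h
      · rw [(Prod.mk.inj h).2] at *
        exact h1
      · exact lt_of_eq_of_lt h.1 hs
    · exact fun h => ⟨z, r, h, rfl⟩
  have hopen : IsOpen {q | ∃ (y : L) (t : Set.Ico (0 : ℝ) 1), (t : ℝ) < s ∧ q = mk y t} :=
    isQuotientMap_quotient_mk'.isOpen_preimage.1 (by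
      have h : IsOpen ({q | (q.2 : ℝ) < s} : Set (L × Set.Ico (0 : ℝ) 1)) :=
        isOpen_lt (by fun_prop) continuous_const
      rw [← hpre] at h
      exact h)
  exact hopen.mem_nhds ⟨y, zero, hs, rfl⟩

/-- Tube lemma: compactness of the link gives one height that works for all of its points at once.
-/
theorem exists_forall_lt_mem [CompactSpace L] (y : L) {A : Set (OpenCone L)}
    (hA : A ∈ 𝓝 (mk y zero)) :
    ∃ s > 0, ∀ (z : L) (t : Set.Ico (0 : ℝ) 1), (t : ℝ) < s → mk z t ∈ A := by
  have h : ∀ᶠ t : Set.Ico (0 : ℝ) 1 in 𝓝 zero, ∀ z ∈ (Set.univ : Set L), mk z t ∈ A := by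
    refine isCompact_univ.eventually_forall_of_forall_eventually fun z _ => ?_
    have h1 : Continuous fun q : Set.Ico (0 : ℝ) 1 × L => mk q.2 q.1 :=
      continuous_mk.comp continuous_swap
    exact h1.continuousAt (x := (zero, z)) (by rwa [mk_zero_eq z y])
  obtain ⟨s, hs, hball⟩ := Metric.eventually_nhds_iff.1 h
  refine ⟨s, hs, fun z t ht => hball ?_ z trivial⟩
  rw [Subtype.dist_eq, Real.dist_eq]
  change abs ((t : ℝ) - 0) < s
  rwa [sub_zero, abs_of_nonneg t.2.1]

theorem mk_mem_cone_piece {m : ℕ} {G : Filtration L m} {y : L} {d : ℤ} (hd : y ∈ G.piece d)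
    {t : Set.Ico (0 : ℝ) 1} (ht : 0 < (t : ℝ)) : mk y t ∈ G.cone.piece (d + 1) := by
  have h0 := Filtration.nonneg_of_mem_piece hd
  have htz : t ≠ zero := fun h => ht.ne' (congrArg Subtype.val h)
  constructor
  · change _ ∈ if d + 1 < 0 then ∅ else subcone (G.skel (d + 1 - 1))
    rw [if_neg (by omega), mk_mem_subcone, add_sub_cancel_right]
    exact Or.inl hd.1
  · change _ ∉ if d + 1 - 1 < 0 then ∅ else subcone (G.skel (d + 1 - 1 - 1))
    rw [if_neg (by omega), mk_mem_subcone, add_sub_cancel_right]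
    exact fun h => h.elim hd.2 htz

end OpenCone

end Cone

section Charts

variable {X : Type*} [TopologicalSpace X] {n : ℕ} {F : Filtration X n} {x : X} {L : Type*}
  [TopologicalSpace L] {m : ℕ} {G : Filtration L m}

/-- Codimension of strata can increase neither along `φ` nor along its inverse, and the round trip
returns to the same stratum; so it is preserved. -/
theorem ConicalChart.map_mem_piece (c : ConicalChart F x G) {z : c.U × OpenCone L} {d : ℤ}
    (hd : z.2 ∈ G.cone.piece d) : (c.φ z : X) ∈ F.piece (c.i + d) := by
  obtain ⟨h1, h2⟩ := c.isStratifiedHomeo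
  have hdim := c.dim_eq
  have hz : z ∈ (G.cone.prod c.U).piece d := hd
  let S := (G.cone.prod c.U).stratumAt z
  obtain ⟨T, hT, hTc⟩ := h1.2 S
  have hzT : c.φ z ∈ T.carrier := hT ⟨z, Filtration.mem_stratumAt _ _, rfl⟩
  obtain ⟨S', hS', hSc'⟩ := h2.2 T
  have hzS' : z ∈ S'.carrier := by
    have := hS' ⟨c.φ z, hzT, rfl⟩
    rwa [Homeomorph.symm_apply_apply] at this
  have hSS' : S' = S := Filtration.Stratum.eq_of_mem hzS' (Filtration.mem_stratumAt _ _)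
  have hSd : S.dim = d := Filtration.stratumAt_dim hz
  rw [hSS'] at hSc'
  have hTd : T.dim = c.i + d := by
    simp only [Filtration.Stratum.codim, hSd] at hTc hSc'
    push_cast at hTc hSc'
    omega
  have := T.carrier_subset hzT
  rwa [hTd] at this

/-- The extension by zero of the identity of `[0,1[`. -/
noncomputable def toIco (t : ℝ) : Set.Ico (0 : ℝ) 1 :=
  open Classical in if h : t ∈ Set.Ico (0 : ℝ) 1 then ⟨t, h⟩ else OpenCone.zero

theorem toIco_of_mem {t : ℝ} (h : t ∈ Set.Ico (0 : ℝ) 1) : toIco t = ⟨t, h⟩ := dif_pos h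

theorem map_toIco_nhds {t : ℝ} (h : t ∈ Set.Ioo (0 : ℝ) 1) :
    Filter.map toIco (𝓝 t) = 𝓝 (toIco t) := by
  have h' : t ∈ Set.Ico (0 : ℝ) 1 := ⟨h.1.le, h.2⟩
  have h1 : Filter.map Subtype.val (𝓝 (⟨t, h'⟩ : Set.Ico (0 : ℝ) 1)) = 𝓝 t :=
    map_nhds_subtype_coe_eq_nhds h' (Ico_mem_nhds h.1 h.2)
  rw [toIco_of_mem h', ← h1, Filter.map_map]
  have : toIco ∘ Subtype.val = (id : Set.Ico (0 : ℝ) 1 → _) := funext fun s => toIco_of_mem s.2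
  rw [this, Filter.map_id]

/-- A parametrization of a neighborhood of the base point of a conical chart in its stratum. -/
theorem ConicalChart.exists_param (c : ConicalChart F x G)
    (hM : IsTopManifold c.i (F.piece c.i)) :
    ∃ ψ : EuclideanSpace ℝ (Fin c.i) → c.U, ψ 0 = ⟨x, c.mem_U⟩ ∧ Set.InjOn ψ (ball 0 1) ∧
      ∀ v ∈ ball 0 1, Filter.map ψ (𝓝 v) = 𝓝 (ψ v) := by
  obtain ⟨-, ⟨_⟩⟩ := hM
  obtain ⟨O, hO, hUO⟩ := c.isOpen_U
  have hsub : c.U ⊆ F.piece c.i := hUO ▸ Set.inter_subset_right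
  have hj : IsOpenEmbedding (Set.inclusion hsub) := by
    refine ⟨IsEmbedding.inclusion hsub, ?_⟩
    rw [Set.range_inclusion]
    have : ({y | (y : X) ∈ c.U} : Set (F.piece c.i)) = Subtype.val ⁻¹' O := by
      ext y
      have hy : (y : X) ∈ F.piece c.i := y.2
      change (y : X) ∈ c.U ↔ (y : X) ∈ O
      rw [hUO]
      exact ⟨fun h => h.1, fun h => ⟨h, hy⟩⟩
    rw [this]
    exact hO.preimage continuous_subtype_val
  let xU : c.U := ⟨x, c.mem_U⟩
  have : Nonempty c.U := ⟨xU⟩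
  let e := (hj.toOpenPartialHomeomorph (Set.inclusion hsub)).trans
    (chartAt (EuclideanSpace ℝ (Fin c.i)) (Set.inclusion hsub xU))
  have hxe : xU ∈ e.source := by simp [e]
  obtain ⟨ε, hε, hball⟩ := Metric.isOpen_iff.1 e.open_target _ (e.map_source hxe)
  -- Rescaling by `ε` and translating carries the unit ball into the target of the manifold chart,
  -- with `0` going to the base point.
  let a : EuclideanSpace ℝ (Fin c.i) ≃ₜ EuclideanSpace ℝ (Fin c.i) :=
    (Homeomorph.smulOfNeZero ε hε.ne').trans (Homeomorph.addLeft (e xU))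
  have ha : ∀ v, a v = e xU + ε • v := fun v => rfl
  have hat : ∀ v ∈ ball 0 1, a v ∈ e.target := fun v hv => by
    refine hball ?_
    rw [mem_ball_zero_iff] at hv
    rw [ha, mem_ball_iff_norm, add_sub_cancel_left, norm_smul, Real.norm_of_nonneg hε.le]
    nlinarith
  refine ⟨fun v => e.symm (a v), ?_, ?_, ?_⟩
  · dsimp only
    rw [ha, smul_zero, add_zero, e.left_inv hxe]
  · intro v hv w hw h
    exact a.injective (e.symm.injOn (hat v hv) (hat w hw) h)
  · intro v hv
    have h1 : Filter.map e.symm (𝓝 (a v)) = 𝓝 (e.symm (a v)) := e.symm.map_nhds_eq (hat v hv)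
    rw [← h1, ← a.map_nhds_eq, Filter.map_map]
    rfl

/-- The chart is combined with a Euclidean parametrization of the stratum and restricted to positive
heights. The first extra clause matches the two embeddings of the link, hence the induced
perversities; the second describes the embedding over nearby base points, for moving the chart along
the stratum. -/
theorem ConicalChart.exists_coneCoords (c : ConicalChart F x G)
    (hM : IsTopManifold c.i (F.piece c.i)) :
    ∃ C : ConeCoords F x c.i G, (∀ y, C.incl (1 / 2) y = c.incl y) ∧
      ∀ᶠ x' in 𝓝[F.piece c.i] x, ∃ h : x' ∈ c.U, ∃ v ∈ ball 0 1,
        ∀ y, (c.φ (⟨x', h⟩, OpenCone.mk y OpenCone.half) : X) = C.chart (v, y, 1 / 2) := by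
  obtain ⟨ψ, hψ0, hψi, hψ⟩ := c.exists_param hM
  have := c.compactSpace
  obtain ⟨O, hO, hUO⟩ := c.isOpen_U
  have hsub : c.U ⊆ F.piece c.i := hUO ▸ Set.inter_subset_right
  obtain ⟨y₀⟩ : Nonempty L := by
    by_contra h
    rw [not_nonempty_iff] at h
    exact c.isFilteredSpace (Subsingleton.elim _ _)
  have hφ0 : (c.φ (⟨x, c.mem_U⟩, OpenCone.mk y₀ OpenCone.zero) : X) = x := c.apex _ _
  have hVal : ∀ z, Filter.map (fun z => (c.φ z : X)) (𝓝 z) = 𝓝 (c.φ z : X) := fun z => by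
    rw [← c.isOpen_V.isOpenEmbedding_subtypeVal.map_nhds_eq, ← c.φ.map_nhds_eq, Filter.map_map]
    rfl
  let E := EuclideanSpace ℝ (Fin c.i)
  let f : E × L × ℝ → X := fun q => c.φ (ψ q.1, OpenCone.mk q.2.1 (toIco q.2.2))
  let D : Set (E × L × ℝ) := ball 0 1 ×ˢ (Set.univ ×ˢ Set.Ioo 0 1)
  have hDo : IsOpen D := isOpen_ball.prod (isOpen_univ.prod isOpen_Ioo)
  have hpos : ∀ {t : ℝ}, t ∈ Set.Ioo (0 : ℝ) 1 → ((toIco t : Set.Ico (0 : ℝ) 1) : ℝ) = t :=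
    fun {t} h => by rw [toIco_of_mem ⟨h.1.le, h.2⟩]
  -- This equality of neighborhood filters gives continuity and openness of `f` at the same time.
  have hnhds : ∀ q ∈ D, Filter.map f (𝓝 q) = 𝓝 (f q) := by
    rintro ⟨v, y, t⟩ ⟨hv, -, ht⟩
    have h1 : Filter.map (fun q : L × ℝ => OpenCone.mk q.1 (toIco q.2)) (𝓝 (y, t)) =
        𝓝 (OpenCone.mk y (toIco t)) := by
      rw [← OpenCone.map_mk_nhds y (t := toIco t) (by rw [hpos ht]; exact ht.1), nhds_prod_eq,
        nhds_prod_eq, ← map_toIco_nhds ht]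
      conv_rhs => rw [← Filter.map_id (f := 𝓝 y), Filter.prod_map_map_eq, Filter.map_map]
      rfl
    change _ = 𝓝 (c.φ (ψ v, OpenCone.mk y (toIco t)) : X)
    rw [← hVal, nhds_prod_eq, nhds_prod_eq (x := ψ v), ← hψ v hv, ← h1, Filter.prod_map_map_eq,
      Filter.map_map]
    rfl
  have hinj : Set.InjOn f D := by
    rintro ⟨v, y, t⟩ ⟨hv, -, ht⟩ ⟨v', y', t'⟩ ⟨hv', -, ht'⟩ h
    have h1 := c.φ.injective (Subtype.ext h)
    rw [Prod.mk.injEq] at h1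
    obtain ⟨rfl, h3⟩ := OpenCone.mk_eq_mk_of_pos (by rw [hpos ht]; exact ht.1) h1.2
    have h4 : v = v' := hψi hv hv' h1.1
    have h5 : t = t' := by
      have := congrArg Subtype.val h3
      dsimp only at this
      rwa [hpos ht, hpos ht'] at this
    rw [h4, h5]
  have : Nonempty (E × L × ℝ) := ⟨(0, y₀, 0)⟩
  let Θ : OpenPartialHomeomorph (E × L × ℝ) X :=
    OpenPartialHomeomorph.ofContinuousOpenRestrict (Set.InjOn.toPartialEquiv f D hinj)
      (fun q hq => ContinuousAt.continuousWithinAt (hnhds q hq).le)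
      (IsOpenMap.of_nhds_le fun q => by
        change 𝓝 (f q) ≤ Filter.map (f ∘ Subtype.val) (𝓝 q)
        rw [← Filter.map_map, show Filter.map Subtype.val (𝓝 q) = 𝓝 (q : E × L × ℝ) from
          hDo.isOpenEmbedding_subtypeVal.map_nhds_eq q]
        exact (hnhds q q.2).ge) hDo
  let C : ConeCoords F x c.i G :=
    { dim_eq := c.dim_eq
      compactSpace := c.compactSpace
      isFilteredSpace := c.isFilteredSpace
      center := fun v => ψ v
      continuousOn_center := fun v hv => ContinuousAt.continuousWithinAt
        (continuous_subtype_val.continuousAt.comp (show ContinuousAt ψ v from (hψ v hv).le))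
      center_zero := by rw [hψ0]
      center_mem := fun v _ => hsub (ψ v).2
      chart := Θ
      source_eq := rfl
      chart_mem := by
        intro v hv t ht y d hd
        have := c.map_mem_piece (z := (ψ v, OpenCone.mk y (toIco t)))
          (OpenCone.mk_mem_cone_piece hd (by rw [hpos ht]; exact ht.1))
        rwa [add_assoc, add_comm 1 d]
      core_mem_nhds := by
        intro s hs
        have hA : ψ '' ball 0 s ∈ 𝓝 (⟨x, c.mem_U⟩ : c.U) := by
          rw [← hψ0, ← hψ 0 (mem_ball_self one_pos)]
          exact Filter.image_mem_map (ball_mem_nhds _ hs.1)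
        have hB := OpenCone.setOf_lt_mem_nhds y₀ hs.1
        have hAB := Filter.image_mem_map (m := fun z => (c.φ z : X))
          (prod_mem_nhds hA hB)
        rw [hVal, hφ0] at hAB
        refine Filter.mem_of_superset hAB ?_
        rintro _ ⟨⟨_, _⟩, ⟨⟨v, hv, rfl⟩, y, t, ht, rfl⟩, rfl⟩
        -- At height 0 the point is the apex over `ψ v`, which belongs to the center and not to the
        -- tube.
        by_cases h0 : (t : ℝ) = 0
        · left
          refine ⟨v, hv, ?_⟩
          have : t = OpenCone.zero := Subtype.ext h0
          rw [this]
          exact (c.apex _ _).symm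
        · right
          refine ⟨(v, y, t), ⟨hv, trivial, lt_of_le_of_ne t.2.1 (Ne.symm h0), ht⟩, ?_⟩
          change (c.φ (ψ v, OpenCone.mk y (toIco t)) : X) = _
          rw [toIco_of_mem t.2]
      exists_core_subset := by
        intro N hN
        rw [← hφ0, ← hVal, Filter.mem_map] at hN
        obtain ⟨A, hA, B, hB, hAB⟩ := mem_nhds_prod_iff.1 hN
        rw [← hψ0, ← hψ 0 (mem_ball_self one_pos), Filter.mem_map] at hA
        obtain ⟨s₁, hs₁, h₁⟩ := Metric.mem_nhds_iff.1 hA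
        -- Here compactness of the link makes the cores a neighborhood basis.
        obtain ⟨s₂, hs₂, h₂⟩ := OpenCone.exists_forall_lt_mem y₀ hB
        refine ⟨min 1 (min s₁ s₂), ⟨by positivity, min_le_left _ _⟩, ?_⟩
        rintro _ (⟨v, hv, rfl⟩ | ⟨⟨v, y, t⟩, ⟨hv, -, ht⟩, rfl⟩)
        · have h3 : ψ v ∈ A := h₁ (ball_subset_ball
            ((min_le_right _ _).trans (min_le_left _ _)) hv)
          have h4 := hAB (Set.mk_mem_prod h3 (h₂ y₀ OpenCone.zero hs₂))
          change (c.φ _ : X) ∈ N at h4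
          rwa [c.apex] at h4
        · have h3 : ψ v ∈ A := h₁ (ball_subset_ball
            ((min_le_right _ _).trans (min_le_left _ _)) hv)
          have ht1 : t ∈ Set.Ioo (0 : ℝ) 1 := ⟨ht.1, ht.2.trans_le (min_le_left _ _)⟩
          refine hAB (Set.mk_mem_prod h3 (h₂ y (toIco t) ?_))
          rw [hpos ht1]
          exact ht.2.trans_le ((min_le_right _ _).trans (min_le_right _ _)) }
  have hhalf : toIco (1 / 2) = OpenCone.half := toIco_of_mem ⟨by norm_num, by norm_num⟩
  refine ⟨C, fun y => ?_, ?_⟩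
  · change (c.φ (ψ 0, OpenCone.mk y (toIco (1 / 2))) : X) = _
    rw [hψ0, hhalf]
    rfl
  · have hA : ψ '' ball 0 1 ∈ 𝓝 (⟨x, c.mem_U⟩ : c.U) := by
      rw [← hψ0, ← hψ 0 (mem_ball_self one_pos)]
      exact Filter.image_mem_map (ball_mem_nhds _ one_pos)
    have hU : Subtype.val '' (ψ '' ball 0 1) ∈ 𝓝[c.U] x := by
      rw [nhdsWithin_eq_map_subtype_coe c.mem_U]
      exact Filter.image_mem_map hA
    have hUx : 𝓝[c.U] x = 𝓝[F.piece c.i] x := by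
      have hxO : x ∈ O := by
        have := c.mem_U
        rw [hUO] at this
        exact this.1
      rw [hUO, nhdsWithin_inter_of_mem (nhdsWithin_le_nhds (hO.mem_nhds hxO))]
    rw [hUx] at hU
    filter_upwards [hU]
    rintro _ ⟨_, ⟨v, hv, rfl⟩, rfl⟩
    refine ⟨(ψ v).2, v, hv, fun y => ?_⟩
    change _ = (c.φ (ψ v, OpenCone.mk y (toIco (1 / 2))) : X)
    rw [hhalf]

end Charts

end Gajer

/-! ### Local structure of CS sets and regular parts of links. -/

namespace Gajer

open Topology Metric

section CSLocal

variable {X : Type u} [TopologicalSpace X] {n : ℕ} {F : Filtration X n}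

theorem Filtration.IsCSSet.exists_coneCoords (hCS : F.IsCSSet) {x : X} {d : ℤ}
    (hd : x ∈ F.piece d) (hdn : d ≠ n) :
    ∃ (L : Type u) (_ : TopologicalSpace L) (m : ℕ) (G : Filtration L m) (i : ℕ)
      (_ : ConeCoords F x i G), F.IsNormal → ConnectedSpace L := by
  have hle := Filtration.le_of_mem_piece F hd
  obtain ⟨L, _, m, G, ⟨c⟩⟩ := hCS.exists_chart x (F.mono (by omega) hd.1)
  obtain ⟨C, -⟩ := c.exists_coneCoords (hCS.isTopManifold c.i)
  exact ⟨L, _, m, G, c.i, C, fun hN => hN x L m G c⟩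

theorem Filtration.IsCSSet.exists_preconnected_nhds (hCS : F.IsCSSet) {x : X}
    (hx : x ∈ F.piece n) {N : Set X} (hN : N ∈ 𝓝 x) :
    ∃ M ∈ 𝓝 x, M ⊆ N ∧ M ⊆ F.piece n ∧ IsPreconnected M := by
  obtain ⟨-, ⟨_⟩⟩ := hCS.isTopManifold n
  have : LocallyConnectedSpace (F.piece n) :=
    ChartedSpace.locallyConnectedSpace (EuclideanSpace ℝ (Fin n)) _
  have h1 : Subtype.val ⁻¹' N ∈ 𝓝 (⟨x, hx⟩ : F.piece n) :=
    continuous_subtype_val.continuousAt hN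
  refine ⟨Subtype.val '' connectedComponentIn (Subtype.val ⁻¹' N) (⟨x, hx⟩ : F.piece n),
    ?_, ?_, ?_, ?_⟩
  · rw [← show Filter.map Subtype.val (𝓝 (⟨x, hx⟩ : F.piece n)) = 𝓝 x from
      F.isOpen_piece_top.isOpenEmbedding_subtypeVal.map_nhds_eq _]
    exact Filter.image_mem_map (connectedComponentIn_mem_nhds h1)
  · rintro _ ⟨z, hz, rfl⟩
    exact connectedComponentIn_subset (Subtype.val ⁻¹' N) _ hz
  · rintro _ ⟨z, hz, rfl⟩
    exact z.2
  · exact isPreconnected_connectedComponentIn.image _ continuous_subtype_val.continuousOn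

/-- CS sets have locally finitely many strata. -/
theorem Filtration.IsCSSet.exists_finite_cover (hCS : F.IsCSSet) (k : ℕ) :
    ∀ (x : X) (d : ℤ), x ∈ F.piece d → n - d ≤ k → ∀ N ∈ 𝓝 x, ∃ 𝒞 : Set (Set X), 𝒞.Finite ∧
      (∀ A ∈ 𝒞, IsPreconnected A ∧ A ⊆ N ∧ ∃ e, A ⊆ F.piece e) ∧ ⋃₀ 𝒞 ∈ 𝓝 x := by
  induction k with
  | zero =>
    intro x d hx hdk N hN
    have hle := Filtration.le_of_mem_piece F hx
    obtain rfl : d = n := by push_cast at hdk; omega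
    obtain ⟨M, hM, hMN, hMp, hMc⟩ := hCS.exists_preconnected_nhds hx hN
    refine ⟨{M}, Set.finite_singleton _, ?_, by rwa [Set.sUnion_singleton]⟩
    rintro _ rfl
    exact ⟨hMc, hMN, _, hMp⟩
  | succ k ih =>
    intro x d hx hdk N hN
    by_cases hdn : d = n
    · exact ih x d hx (by omega) N hN
    obtain ⟨L, _, m, G, i, C, -⟩ := hCS.exists_coneCoords hx hdn
    have hid : (i : ℤ) = d := Filtration.piece_unique C.mem_piece hx
    -- Points of the tube have smaller codimension than `x`, so the induction hypothesis applies to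
    -- them and the link has finitely many strata.
    have : Finite G.Stratum := C.finite_stratum fun w hw => by
      obtain ⟨e, he⟩ := F.exists_mem_piece w
      have := C.lt_of_mem_tube hw he
      exact ih w e he (by push_cast at hdk; omega)
    obtain ⟨s, hs, hsN⟩ := C.exists_core_subset N hN
    have hcore := C.core_mem_nhds s hs
    -- The cover consists of the center and, for each stratum of the link, the part of the tube over
    -- it.
    refine ⟨insert (C.center '' ball 0 s) (Set.range fun T : G.Stratum =>
      C.chart '' (ball 0 s ×ˢ (T.carrier ×ˢ Set.Ioo 0 s))), (Set.finite_range _).insert _, ?_,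
      Filter.mem_of_superset hcore ?_⟩
    · rintro _ (rfl | ⟨T, rfl⟩)
      · refine ⟨(convex_ball _ _).isPreconnected.image _
          (C.continuousOn_center.mono (ball_subset_ball hs.2)),
          Set.subset_union_left.trans hsN, i, ?_⟩
        rintro _ ⟨v, hv, rfl⟩
        exact C.center_mem v (ball_subset_ball hs.2 hv)
      · have hsub : (ball (0 : EuclideanSpace ℝ (Fin i)) s ×ˢ (T.carrier ×ˢ Set.Ioo 0 s)) ⊆
            ball 0 s ×ˢ (Set.univ ×ˢ Set.Ioo 0 s) := fun q hq => ⟨hq.1, trivial, hq.2.2⟩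
        refine ⟨IsPreconnected.image ?_ _ (C.chart.continuousOn.mono
          (hsub.trans (C.prod_subset_source hs.2))),
          (Set.image_mono hsub).trans (Set.subset_union_right.trans hsN), i + 1 + T.dim, ?_⟩
        · exact (convex_ball _ _).isPreconnected.prod (T.isPreconnected.prod isPreconnected_Ioo)
        · rintro _ ⟨⟨v, y, t⟩, ⟨hv, hy, ht⟩, rfl⟩
          exact C.chart_mem v (ball_subset_ball hs.2 hv) t ⟨ht.1, ht.2.trans_le hs.2⟩ y _
            (T.carrier_subset hy)
    · rintro w (hw | ⟨⟨v, y, t⟩, ⟨hv, -, ht⟩, rfl⟩)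
      · exact ⟨_, Set.mem_insert _ _, hw⟩
      · exact ⟨_, Set.mem_insert_of_mem _ ⟨G.stratumAt y, rfl⟩, (v, y, t),
          ⟨hv, G.mem_stratumAt y, ht⟩, rfl⟩

/-- The links of a CS set have finitely many strata. -/
theorem Filtration.IsCSSet.finite_stratum (hCS : F.IsCSSet) {x : X} {i : ℕ} {L : Type*}
    [TopologicalSpace L] {m : ℕ} {G : Filtration L m} (C : ConeCoords F x i G) :
    Finite G.Stratum := by
  refine C.finite_stratum fun w _ => ?_
  obtain ⟨e, he⟩ := F.exists_mem_piece w
  exact hCS.exists_finite_cover (n - e).toNat w e he (Int.self_le_toNat _)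

/-- The tube over a connected link is open and connected, so local connectedness of the regular part
propagates over it. -/
theorem ConeCoords.isPreconnected_tube_inter {x : X} {i : ℕ} {L : Type*} [TopologicalSpace L]
    [PreconnectedSpace L] {m : ℕ} {G : Filtration L m} (C : ConeCoords F x i G)
    (h : ∀ w ∈ C.chart.target, ∀ N ∈ 𝓝 w, ∃ M ∈ 𝓝 w, M ⊆ N ∧ (M ∩ F.piece n).Nonempty ∧
      IsPreconnected (M ∩ F.piece n)) {s : ℝ} (hs : s ≤ 1) :
    IsPreconnected (C.tube s ∩ F.piece n) :=
  isPreconnected_inter_of_local (C.isOpen_tube hs) (C.isPreconnected_tube hs)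
    fun w hw => h w (C.tube_one ▸ C.tube_mono hs hw)

/-- In a normal CS set, the regular part is locally connected around all points. -/
theorem Filtration.IsCSSet.exists_preconnected_regular (hCS : F.IsCSSet) (hN : F.IsNormal)
    (k : ℕ) : ∀ (x : X) (d : ℤ), x ∈ F.piece d → n - d ≤ k → ∀ N ∈ 𝓝 x, ∃ M ∈ 𝓝 x, M ⊆ N ∧
      (M ∩ F.piece n).Nonempty ∧ IsPreconnected (M ∩ F.piece n) := by
  induction k with
  | zero =>
    intro x d hx hdk N hN
    have hle := Filtration.le_of_mem_piece F hx
    obtain rfl : d = n := by push_cast at hdk; omega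
    obtain ⟨M, hM, hMN, hMp, hMc⟩ := hCS.exists_preconnected_nhds hx hN
    exact ⟨M, hM, hMN, ⟨x, mem_of_mem_nhds hM, hx⟩, by rwa [Set.inter_eq_left.2 hMp]⟩
  | succ k ih =>
    intro x d hx hdk N hNx
    by_cases hdn : d = n
    · exact ih x d hx (by omega) N hNx
    obtain ⟨L, _, m, G, i, C, hL⟩ := hCS.exists_coneCoords hx hdn
    have := hL hN
    have hid : (i : ℤ) = d := Filtration.piece_unique C.mem_piece hx
    obtain ⟨s, hs, hsN⟩ := C.exists_core_subset N hNx
    -- The center lies in the piece of dimension `i ≠ n` and so contains no regular points.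
    have heq : C.core s ∩ F.piece n = C.tube s ∩ F.piece n := by
      refine Set.Subset.antisymm (fun w hw => ⟨?_, hw.2⟩) (fun w hw => ⟨Or.inr hw.1, hw.2⟩)
      exact C.mem_tube_of_mem_core s hw.1 hs.2 fun hi =>
        hdn (hid ▸ Filtration.piece_unique hi hw.2)
    refine ⟨C.core s, C.core_mem_nhds s hs, hsN, ?_, ?_⟩
    · rw [heq]
      obtain ⟨y, hy⟩ := C.exists_regular
      have ht : s / 2 ∈ Set.Ioo 0 s := ⟨by linarith [hs.1], by linarith [hs.1]⟩
      refine ⟨C.incl (s / 2) y, C.incl_mem_tube ht y, ?_⟩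
      have h1 := C.chart_mem 0 (mem_ball_self one_pos) (s / 2)
        ⟨ht.1, ht.2.trans_le hs.2⟩ y m hy
      have h2 := C.dim_eq
      rwa [show (i : ℤ) + 1 + m = n by omega] at h1
    · rw [heq]
      refine C.isPreconnected_tube_inter (fun w hw => ?_) hs.2
      obtain ⟨e, he⟩ := F.exists_mem_piece w
      have := C.lt_of_mem_tube hw he
      exact ih w e he (by push_cast at hdk; omega)

/-- In a normal CS set, the regular part of a link is path connected. -/
theorem Filtration.IsCSSet.joinedIn_regular (hCS : F.IsCSSet) (hN : F.IsNormal) {x : X} {i : ℕ}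
    {L : Type*} [TopologicalSpace L] [PreconnectedSpace L] {m : ℕ} {G : Filtration L m}
    (C : ConeCoords F x i G) {y y' : L} (hy : y ∉ G.skel (m - 1)) (hy' : y' ∉ G.skel (m - 1)) :
    JoinedIn (G.skel (m - 1))ᶜ y y' := by
  rw [Filtration.notMem_skel_pred_iff] at hy hy'
  have hdim := C.dim_eq
  have hpc : IsPreconnected (C.tube 1 ∩ F.piece n) :=
    C.isPreconnected_tube_inter (fun w _ => by
      obtain ⟨e, he⟩ := F.exists_mem_piece w
      exact hCS.exists_preconnected_regular hN (n - e).toNat w e he (Int.self_le_toNat _)) le_rfl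
  have hmem : ∀ z ∈ G.piece m, C.incl (1 / 2) z ∈ C.tube 1 ∩ F.piece n := fun z hz => by
    refine ⟨C.incl_mem_tube ConeCoords.half_mem z, ?_⟩
    have h1 := C.chart_mem 0 (mem_ball_self one_pos) (1 / 2) ConeCoords.half_mem z m hz
    rwa [show (i : ℤ) + 1 + m = n by omega] at h1
  obtain ⟨-, ⟨_⟩⟩ := hCS.isTopManifold n
  have : LocallyPathConnectedSpace (F.piece n) :=
    ChartedSpace.locallyPathConnectedSpace (EuclideanSpace ℝ (Fin n)) _
  have himg : Subtype.val '' (Subtype.val ⁻¹' C.tube 1 : Set (F.piece n)) =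
      C.tube 1 ∩ F.piece n := by
    rw [Subtype.image_preimage_coe, Set.inter_comm]
  have hconn : IsConnected (Subtype.val ⁻¹' C.tube 1 : Set (F.piece n)) := by
    refine ⟨⟨⟨_, (hmem y hy).2⟩, (hmem y hy).1⟩, ?_⟩
    rw [← IsInducing.subtypeVal.isPreconnected_image, himg]
    exact hpc
  -- The regular part is a manifold, hence locally path connected, so its connected open subsets are
  -- path connected. The path found in the tube is afterwards projected to the link.
  have hpath := ((C.isOpen_tube le_rfl).preimage
    continuous_subtype_val).isConnected_iff_isPathConnected.1 hconn
  have hpath' : IsPathConnected (C.tube 1 ∩ F.piece n) := by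
    rw [← himg]
    exact hpath.image continuous_subtype_val
  have hj := hpath'.joinedIn _ (hmem y hy) _ (hmem y' hy')
  have hcont : ContinuousOn C.proj (C.tube 1 ∩ F.piece n) :=
    C.continuousOn_proj.mono fun w hw => C.tube_one ▸ hw.1
  have hj' := hj.map_continuousOn hcont
  simp only [ConeCoords.incl, C.proj_chart (mem_ball_self one_pos) ConeCoords.half_mem] at hj'
  refine hj'.mono ?_
  rintro _ ⟨w, hw, rfl⟩
  rw [Set.mem_compl_iff, Filtration.notMem_skel_pred_iff]
  have := C.proj_mem_piece (C.tube_one ▸ hw.1) hw.2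
  rwa [show (n : ℤ) - i - 1 = m by omega] at this

end CSLocal

/-! ### Comparison of two links of the same point. -/

section Comparison

variable {X : Type u} [TopologicalSpace X] {n : ℕ} {F : Filtration X n} {x : X}

namespace ConeCoords

variable {i₁ i₂ : ℕ} {L₁ L₂ : Type u} [TopologicalSpace L₁] [TopologicalSpace L₂] {m₁ m₂ : ℕ}
  {G₁ : Filtration L₁ m₁} {G₂ : Filtration L₂ m₂}

/-- A perversity on the link that is read off from one on the ambient space. -/
def IsInduced {i : ℕ} {L : Type*} [TopologicalSpace L] {m : ℕ} {G : Filtration L m}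
    (C : ConeCoords F x i G) (p : F.Perversity) (q : G.Perversity) : Prop :=
  ∀ y, q.val (G.stratumAt y) = p.val (C.label y)

/-- The label determines both the codimension and the value of the induced perversity, the only data
that enter allowability. -/
theorem isFull_of_label_eq {x₁ x₂ : X} {C₁ : ConeCoords F x₁ i₁ G₁} {C₂ : ConeCoords F x₂ i₂ G₂}
    (hfin : Finite G₁.Stratum) {p : F.Perversity} {q₁ : G₁.Perversity} {q₂ : G₂.Perversity}
    (h₁ : C₁.IsInduced p q₁) (h₂ : C₂.IsInduced p q₂) {ℓ : ℕ}
    {σ : C(stdSimplex ℝ (Fin (ℓ + 1)), L₁)} (hσ : IsFull q₁ σ)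
    {τ : C(stdSimplex ℝ (Fin (ℓ + 1)), L₂)} (h : ∀ z, C₂.label (τ z) = C₁.label (σ z)) :
    IsFull q₂ τ :=
  hσ.of_label hfin (fun z => by rw [← C₁.label_codim, ← C₂.label_codim, h])
    (fun z => by rw [h₁, h₂, h])

/-- For conical coordinates at the same point, of which the conical neighborhoods are nested, the copy of the
first link at height `a` lies in the tube of size `b` of the second one. -/
theorem incl_mem_tube_of_core_subset (C₁ : ConeCoords F x i₁ G₁) (C₂ : ConeCoords F x i₂ G₂)
    {a a₀ b : ℝ} (ha : a ∈ Set.Ioo 0 a₀) (ha₀ : a₀ ≤ 1) (hb : b ≤ 1)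
    (h : C₁.core a₀ ⊆ C₂.core b) (y : L₁) : C₁.incl a y ∈ C₂.tube b := by
  have h1 := C₁.incl_mem_tube ha y
  refine C₂.mem_tube_of_mem_core b (h (Or.inr h1)) hb fun hi => ?_
  have h2 := C₁.lt_of_mem_tube (C₁.tube_one ▸ C₁.tube_mono ha₀ h1) hi
  have h3 := Filtration.piece_unique C₁.mem_piece C₂.mem_piece
  omega

/-- The comparison map between two links. -/
noncomputable def transfer (C₁ : ConeCoords F x i₁ G₁) (C₂ : ConeCoords F x i₂ G₂) {a : ℝ}
    (ha : a ∈ Set.Ioo (0 : ℝ) 1) (h : ∀ y, C₁.incl a y ∈ C₂.tube 1) : C(L₁, L₂) :=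
  ⟨fun y => C₂.proj (C₁.incl a y), C₂.continuousOn_proj.comp_continuous (C₁.continuous_incl ha)
    fun y => C₂.tube_one ▸ h y⟩

theorem label_incl (C₁ : ConeCoords F x i₁ G₁) {a : ℝ} (ha : a ∈ Set.Ioo (0 : ℝ) 1) (y : L₁) :
    F.stratumAt (C₁.incl a y) = C₁.label y :=
  C₁.stratumAt_chart (mem_ball_self one_pos) ha

/-- Projecting to a link keeps the stratum of `X`, and so does sliding the link to another height.
-/
theorem label_transfer (C₁ : ConeCoords F x i₁ G₁) (C₂ : ConeCoords F x i₂ G₂) {a : ℝ}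
    (ha : a ∈ Set.Ioo (0 : ℝ) 1) (h : ∀ y, C₁.incl a y ∈ C₂.tube 1) (y : L₁) :
    C₂.label (transfer C₁ C₂ ha h y) = C₁.label y :=
  (C₂.label_proj (C₂.tube_one ▸ h y)).trans (C₁.label_incl ha y)

/-- The composite of the comparison maps between two links is homotopic to the identity, along
strata of the ambient space. -/
theorem exists_homotopy_transfer (C₁ : ConeCoords F x i₁ G₁) (C₂ : ConeCoords F x i₂ G₂)
    {a b a₀ b₀ : ℝ} (ha : a ∈ Set.Ioo 0 a₀) (ha₀ : a₀ ≤ 1) (hb : b ∈ Set.Ioo 0 b₀) (hb₀ : b₀ ≤ 1)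
    (ha1 : a ∈ Set.Ioo (0 : ℝ) 1) (hb1 : b ∈ Set.Ioo (0 : ℝ) 1)
    (h₂₁ : C₂.core b₀ ⊆ C₁.core 1) (h₁₂ : C₁.core a₀ ⊆ C₂.core b₀)
    (h : ∀ y, C₁.incl a y ∈ C₂.tube 1) (h' : ∀ y, C₂.incl b y ∈ C₁.tube 1) :
    ∃ H : C(L₁ × unitInterval, L₁), (∀ y, H (y, 0) = y) ∧
      (∀ y, H (y, 1) = transfer C₂ C₁ hb1 h' (transfer C₁ C₂ ha1 h y)) ∧
      ∀ q, C₁.label (H q) = C₁.label q.1 := by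
  let Q : L₁ × unitInterval → EuclideanSpace ℝ (Fin i₂) × L₂ × ℝ := fun q =>
    C₂.chart.symm (C₁.incl a q.1)
  have hQc : Continuous Q := C₂.chart.continuousOn_symm.comp_continuous
    ((C₁.continuous_incl ha1).comp continuous_fst) fun q => C₂.tube_one ▸ h q.1
  have hQ : ∀ q, Q q ∈ ball (0 : EuclideanSpace ℝ (Fin i₂)) b₀ ×ˢ
      ((Set.univ : Set L₂) ×ˢ Set.Ioo 0 b₀) := fun q => by
    obtain ⟨w, hw, hwq⟩ := incl_mem_tube_of_core_subset C₁ C₂ ha ha₀ hb₀ h₁₂ q.1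
    have : Q q = w := by
      change C₂.chart.symm (C₁.incl a q.1) = w
      rw [← hwq, C₂.chart.left_inv (C₂.prod_subset_source hb₀ hw)]
    rwa [this]
  -- In the second coordinates the point moves straight to `(0, ·, b)` with its link coordinate
  -- fixed, ending on the copy of `L₂` at height `b`. By convexity it stays in the box of size `b₀`.
  let R : L₁ × unitInterval → EuclideanSpace ℝ (Fin i₂) × L₂ × ℝ := fun q =>
    ((1 - (q.2 : ℝ)) • (Q q).1, (Q q).2.1, (1 - (q.2 : ℝ)) * (Q q).2.2 + q.2 * b)
  have hRc : Continuous R := by fun_prop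
  have hR : ∀ q, R q ∈ ball (0 : EuclideanSpace ℝ (Fin i₂)) b₀ ×ˢ
      ((Set.univ : Set L₂) ×ˢ Set.Ioo 0 b₀) := fun q => by
    obtain ⟨hv, -, ht⟩ := hQ q
    refine ⟨?_, trivial, ?_⟩
    · rw [mem_ball_zero_iff] at hv ⊢
      refine lt_of_le_of_lt ?_ hv
      rw [norm_smul, Real.norm_of_nonneg (by linarith [q.2.2.2])]
      exact mul_le_of_le_one_left (norm_nonneg _) (by linarith [q.2.2.1])
    · exact (convex_Ioo 0 b₀) ht hb (by linarith [q.2.2.2]) q.2.2.1 (by ring)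
  have hRs : ∀ q, R q ∈ C₂.chart.source := fun q => C₂.prod_subset_source hb₀ (hR q)
  -- The tube of size `b₀` lies in the first core and misses the piece of `x`, so the moving point
  -- can be projected to `L₁` at all times.
  have hRt : ∀ q, C₂.chart (R q) ∈ C₁.chart.target := fun q => by
    rw [← C₁.tube_one]
    have h1 : C₂.chart (R q) ∈ C₂.tube b₀ := ⟨R q, hR q, rfl⟩
    refine C₁.mem_tube_of_mem_core 1 (h₂₁ (Or.inr h1)) le_rfl fun hi => ?_
    have h2 := C₂.lt_of_mem_tube (C₂.tube_one ▸ C₂.tube_mono hb₀ h1) hi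
    have h3 := Filtration.piece_unique C₁.mem_piece C₂.mem_piece
    omega
  have hRQ : ∀ y, R (y, 0) = Q (y, 0) := fun y => by
    simp only [R, Set.Icc.coe_zero, sub_zero, one_smul, one_mul, zero_mul, add_zero]
  refine ⟨⟨fun q => C₁.proj (C₂.chart (R q)), C₁.continuousOn_proj.comp_continuous
    (C₂.chart.continuousOn.comp_continuous hRc hRs) hRt⟩, fun y => ?_, fun y => ?_, fun q => ?_⟩
  · change C₁.proj (C₂.chart (R (y, 0))) = y
    rw [hRQ, C₂.chart.right_inv (C₂.tube_one ▸ h y)]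
    exact C₁.proj_chart (mem_ball_self one_pos) ha1
  · change C₁.proj (C₂.chart (R (y, 1))) = C₁.proj (C₂.chart (0, (Q (y, 1)).2.1, b))
    simp only [R, Set.Icc.coe_one, sub_self, zero_smul, zero_mul, zero_add, one_mul]
  · change C₁.label (C₁.proj (C₂.chart (R q))) = C₁.label q.1
    obtain ⟨hv, ht⟩ := C₂.mem_source.1 (hRs q)
    rw [C₁.label_proj (hRt q)]
    refine (C₂.stratumAt_chart hv ht).trans ?_
    exact (C₂.label_proj (C₂.tube_one ▸ h q.1)).trans (C₁.label_incl ha1 q.1)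

/-- Links at the same point have isomorphic intersection homotopy groups. -/
theorem nonempty_mulEquiv (hCS : F.IsCSSet) (hN : F.IsNormal) (C₁ : ConeCoords F x i₁ G₁)
    (C₂ : ConeCoords F x i₂ G₂) [PreconnectedSpace L₂] {p : F.Perversity} {q₁ : G₁.Perversity}
    {q₂ : G₂.Perversity} (hq₁ : C₁.IsInduced p q₁) (hq₂ : C₂.IsInduced p q₂)
    {y₁ : L₁} {y₂ : L₂} (hy₁ : y₁ ∉ G₁.skel (m₁ - 1)) (hy₂ : y₂ ∉ G₂.skel (m₂ - 1)) (ℓ : ℕ)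
    [NeZero ℓ] :
    Nonempty (IntersectionHomotopyGroup ℓ q₁ y₁ hy₁ ≃* IntersectionHomotopyGroup ℓ q₂ y₂ hy₂) := by
  have hfin₁ := hCS.finite_stratum C₁
  have hfin₂ := hCS.finite_stratum C₂
  have hone : (1 : ℝ) ∈ Set.Ioc (0 : ℝ) 1 := ⟨one_pos, le_rfl⟩
  -- Each homotopy needs a nesting of three cores: `1`, `b₀`, `a₀` for the one on `L₁`, and `1`,
  -- `a₁`, `b₁` for the one on `L₂`. Heights `a`, `b` below both bounds serve the two homotopies
  -- with the same comparison maps.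
  obtain ⟨b₀, hb₀, hb₀'⟩ := C₂.exists_core_subset _ (C₁.core_mem_nhds 1 hone)
  obtain ⟨a₀, ha₀, ha₀'⟩ := C₁.exists_core_subset _ (C₂.core_mem_nhds b₀ hb₀)
  obtain ⟨a₁, ha₁, ha₁'⟩ := C₁.exists_core_subset _ (C₂.core_mem_nhds 1 hone)
  obtain ⟨b₁, hb₁, hb₁'⟩ := C₂.exists_core_subset _ (C₁.core_mem_nhds a₁ ha₁)
  obtain ⟨a, ha, haa⟩ := exists_between (lt_min ha₀.1 ha₁.1)
  obtain ⟨b, hb, hbb⟩ := exists_between (lt_min hb₀.1 hb₁.1)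
  rw [lt_min_iff] at haa hbb
  have ha1 : a ∈ Set.Ioo (0 : ℝ) 1 := ⟨ha, haa.1.trans_le ha₀.2⟩
  have hb1 : b ∈ Set.Ioo (0 : ℝ) 1 := ⟨hb, hbb.1.trans_le hb₀.2⟩
  have h := incl_mem_tube_of_core_subset C₁ C₂ ⟨ha, haa.2⟩ ha₁.2 le_rfl ha₁'
  have h' := incl_mem_tube_of_core_subset C₂ C₁ ⟨hb, hbb.1⟩ hb₀.2 le_rfl hb₀'
  obtain ⟨H, H0, H1, HL⟩ := exists_homotopy_transfer C₁ C₂ ⟨ha, haa.1⟩ ha₀.2 ⟨hb, hbb.1⟩ hb₀.2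
    ha1 hb1 hb₀' ha₀' h h'
  obtain ⟨H', H0', H1', HL'⟩ := exists_homotopy_transfer C₂ C₁ ⟨hb, hbb.2⟩ hb₁.2 ⟨ha, haa.2⟩ ha₁.2
    hb1 ha1 ha₁' hb₁' h' h
  -- Regular means codimension 0, and codimension is read off from the label.
  have hreg : transfer C₁ C₂ ha1 h y₁ ∉ G₂.skel (m₂ - 1) := by
    have h1 := C₁.label_codim y₁
    rw [← label_transfer C₁ C₂ ha1 h, C₂.label_codim] at h1
    obtain ⟨d, hd⟩ := G₂.exists_mem_piece (transfer C₁ C₂ ha1 h y₁)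
    rw [Filtration.notMem_skel_pred_iff] at hy₁ ⊢
    rw [Filtration.Stratum.codim, Filtration.Stratum.codim, Filtration.stratumAt_dim hd,
      Filtration.stratumAt_dim hy₁] at h1
    rwa [show d = (m₂ : ℤ) by omega] at hd
  exact nonempty_mulEquiv_of_preservesFull (f := transfer C₁ C₂ ha1 h)
    (g := transfer C₂ C₁ hb1 h') (h := H) (h' := H')
    (fun _ _ hσ => isFull_of_label_eq hfin₁ hq₁ hq₂ hσ fun z => label_transfer C₁ C₂ ha1 h _)
    (fun _ _ hσ => isFull_of_label_eq hfin₂ hq₂ hq₁ hσ fun z => label_transfer C₂ C₁ hb1 h' _)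
    (fun _ _ _ hσ => isFull_of_label_eq hfin₁ hq₁ hq₁ hσ fun z => HL _) H0 H1
    (fun _ _ _ hσ => isFull_of_label_eq hfin₂ hq₂ hq₂ hσ fun z => HL' _) H0' H1'
    hy₁ hy₂ (hCS.joinedIn_regular hN C₂ hreg hy₂) ℓ

end ConeCoords

/-- The perversity induced by a conical chart is induced in the sense of conical coordinates. -/
theorem ConicalChart.isInduced_perversity {L : Type*} [TopologicalSpace L] {m : ℕ}
    {G : Filtration L m} (c : ConicalChart F x G) (C : ConeCoords F x c.i G)
    (h : ∀ y, C.incl (1 / 2) y = c.incl y) (p : F.Perversity) : C.IsInduced p (c.perversity p) := by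
  intro y
  change p.val (F.stratumAt (c.incl (G.stratumAt y).nonempty.choose)) = _
  rw [← h]
  exact congrArg p.val (C.label_eq_of_mem (G.stratumAt y).nonempty.choose_spec (G.mem_stratumAt y))

/-- A conical chart at `x` is a conical chart at the other points of its part of the stratum. -/
def ConicalChart.moveTo {L : Type*} [TopologicalSpace L] {m : ℕ} {G : Filtration L m}
    (c : ConicalChart F x G) {x' : X} (h : x' ∈ c.U) (hV : x' ∈ c.V) (hp : x' ∈ F.piece c.i) :
    ConicalChart F x' G :=
  { c with
    mem_piece := hp
    mem_V := hV
    mem_U := h }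

/-- Near `x` in its piece, the embeddings of the link over `x'` and over `x` differ only by the ball
coordinate, on which the stratum does not depend. -/
theorem ConicalChart.eventually_perversity_eq {L : Type*} [TopologicalSpace L] {m : ℕ}
    {G : Filtration L m} (c : ConicalChart F x G) (hM : IsTopManifold c.i (F.piece c.i))
    (p : F.Perversity) :
    ∀ᶠ x' in 𝓝[F.piece c.i] x, ∃ c' : ConicalChart F x' G, c'.perversity p = c.perversity p := by
  obtain ⟨C, hC, hev⟩ := c.exists_coneCoords hM
  filter_upwards [hev, self_mem_nhdsWithin, nhdsWithin_le_nhds (c.isOpen_V.mem_nhds c.mem_V)]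
    with x' hx' hp hV
  obtain ⟨hU, v, hv, hy⟩ := hx'
  refine ⟨c.moveTo hU hV hp, ?_⟩
  have : ∀ T : G.Stratum, ((c.moveTo hU hV hp).perversity p).val T = (c.perversity p).val T := by
    intro T
    change p.val (F.stratumAt ((c.moveTo hU hV hp).incl _)) = p.val (F.stratumAt (c.incl _))
    rw [← hC]
    refine congrArg p.val (Eq.trans ?_ (C.stratumAt_chart hv ConeCoords.half_mem))
    exact congrArg F.stratumAt (hy _)
  have hval : ((c.moveTo hU hV hp).perversity p).val = (c.perversity p).val := funext this
  revert hval
  generalize (c.moveTo hU hV hp).perversity p = q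
  generalize c.perversity p = q'
  intro hval
  cases q; cases q'; cases hval; rfl

/-- Links at the same point have isomorphic intersection homotopy groups. -/
theorem ConicalChart.nonempty_mulEquiv (hCS : F.IsCSSet) (hN : F.IsNormal) (p : F.Perversity)
    {L₁ L₂ : Type u} [TopologicalSpace L₁] [TopologicalSpace L₂] {m₁ m₂ : ℕ}
    {G₁ : Filtration L₁ m₁} {G₂ : Filtration L₂ m₂} (c₁ : ConicalChart F x G₁)
    (c₂ : ConicalChart F x G₂) {y₁ : L₁} {y₂ : L₂} (hy₁ : y₁ ∉ G₁.skel (m₁ - 1))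
    (hy₂ : y₂ ∉ G₂.skel (m₂ - 1)) (ℓ : ℕ) [NeZero ℓ] :
    Nonempty (IntersectionHomotopyGroup ℓ (c₁.perversity p) y₁ hy₁ ≃*
      IntersectionHomotopyGroup ℓ (c₂.perversity p) y₂ hy₂) := by
  obtain ⟨C₁, hC₁, -⟩ := c₁.exists_coneCoords (hCS.isTopManifold c₁.i)
  obtain ⟨C₂, hC₂, -⟩ := c₂.exists_coneCoords (hCS.isTopManifold c₂.i)
  have : ConnectedSpace L₂ := hN x L₂ m₂ G₂ c₂
  exact ConeCoords.nonempty_mulEquiv hCS hN C₁ C₂ (c₁.isInduced_perversity C₁ hC₁ p)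
    (c₂.isInduced_perversity C₂ hC₂ p) hy₁ hy₂ ℓ

end Comparison

end Gajer

/-! ### Passage along the stratum. -/

theorem proposition2 {X : Type u} [TopologicalSpace X] {n : ℕ} (F : Gajer.Filtration X n)
    (hCS : F.IsCSSet) (hN : F.IsNormal) (p : F.Perversity)
    (S : F.Stratum) (hS : S.IsSingular)
    (x₁ x₂ : X) (hx₁ : x₁ ∈ S.carrier) (hx₂ : x₂ ∈ S.carrier)
    {L₁ L₂ : Type u} [TopologicalSpace L₁] [TopologicalSpace L₂] {m₁ m₂ : ℕ}
    {G₁ : Gajer.Filtration L₁ m₁} {G₂ : Gajer.Filtration L₂ m₂}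
    (c₁ : Gajer.ConicalChart F x₁ G₁) (c₂ : Gajer.ConicalChart F x₂ G₂)
    (y₁ : L₁) (hy₁ : y₁ ∉ G₁.skel (m₁ - 1)) (y₂ : L₂) (hy₂ : y₂ ∉ G₂.skel (m₂ - 1))
    (ℓ : ℕ) [NeZero ℓ] :
    Nonempty (Gajer.IntersectionHomotopyGroup ℓ (c₁.perversity p) y₁ hy₁ ≃*
      Gajer.IntersectionHomotopyGroup ℓ (c₂.perversity p) y₂ hy₂) := by
  -- Quantifying over all charts and regular base points turns the comparison into a relation on
  -- points of the stratum, to which connectedness applies.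
  let P : X → X → Prop := fun x x' => ∀ (L L' : Type u) [TopologicalSpace L] [TopologicalSpace L']
    (m m' : ℕ) (G : Gajer.Filtration L m) (G' : Gajer.Filtration L' m')
    (c : Gajer.ConicalChart F x G) (c' : Gajer.ConicalChart F x' G')
    (y : L) (hy : y ∉ G.skel (m - 1)) (y' : L') (hy' : y' ∉ G'.skel (m' - 1)),
    Nonempty (Gajer.IntersectionHomotopyGroup ℓ (c.perversity p) y hy ≃*
      Gajer.IntersectionHomotopyGroup ℓ (c'.perversity p) y' hy')
  have hchart : ∀ x ∈ S.carrier, ∃ (L : Type u) (_ : TopologicalSpace L) (m : ℕ)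
      (G : Gajer.Filtration L m), Nonempty (Gajer.ConicalChart F x G) := fun x hx => by
    have h1 := S.carrier_subset hx
    have h2 := Gajer.Filtration.le_of_mem_piece F h1
    have h3 : S.dim ≠ n := hS
    exact hCS.exists_chart x (F.mono (by omega) h1.1)
  have key : P x₁ x₂ := by
    refine S.isPreconnected.induction₂ P ?_ ?_ ?_ hx₁ hx₂
    · intro x hx
      obtain ⟨K, _, k, H, ⟨c₀⟩⟩ := hchart x hx
      obtain ⟨C, -⟩ := c₀.exists_coneCoords (hCS.isTopManifold c₀.i)
      obtain ⟨z, hz⟩ := C.exists_regular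
      have hz' : z ∉ H.skel (k - 1) := Gajer.Filtration.notMem_skel_pred_iff.2 hz
      have hd : S.dim = c₀.i := Gajer.Filtration.piece_unique (S.carrier_subset hx) c₀.mem_piece
      have hsub : S.carrier ⊆ F.piece c₀.i := hd ▸ S.carrier_subset
      -- A chart `c₀` at `x` is moved to `x'` with its link, perversity and base point `z`
      -- unchanged. It mediates between a given chart at `x` and one at `x'`.
      filter_upwards [nhdsWithin_mono x hsub
        (c₀.eventually_perversity_eq (hCS.isTopManifold c₀.i) p)] with x' hx'
      intro L L' _ _ m m' G G' c c' y hy y' hy'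
      obtain ⟨c₀', hc₀'⟩ := hx'
      obtain ⟨e⟩ := Gajer.ConicalChart.nonempty_mulEquiv hCS hN p c c₀ hy hz' ℓ
      obtain ⟨e'⟩ := Gajer.ConicalChart.nonempty_mulEquiv hCS hN p c₀' c' hz' hy' ℓ
      rw [hc₀'] at e'
      exact ⟨e.trans e'⟩
    · intro a b d ha hb hd hab hbd L L' _ _ m m' G G' c c' y hy y' hy'
      -- Transitivity needs an actual chart and a regular point of its link at the middle point;
      -- otherwise the two hypotheses could be vacuous.
      obtain ⟨K, _, k, H, ⟨c₀⟩⟩ := hchart b hb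
      obtain ⟨C, -⟩ := c₀.exists_coneCoords (hCS.isTopManifold c₀.i)
      obtain ⟨z, hz⟩ := C.exists_regular
      have hz' : z ∉ H.skel (k - 1) := Gajer.Filtration.notMem_skel_pred_iff.2 hz
      obtain ⟨e⟩ := hab L K m k G H c c₀ y hy z hz'
      obtain ⟨e'⟩ := hbd K L' k m' H G' c₀ c' z hz' y' hy'
      exact ⟨e.trans e'⟩
    · intro a b ha hb hab L L' _ _ m m' G G' c c' y hy y' hy'
      obtain ⟨e⟩ := hab L' L m' m G' G c' c y' hy' y hy
      exact ⟨e.symm⟩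
  exact key L₁ L₂ m₁ m₂ G₁ G₂ c₁ c₂ y₁ hy₁ y₂ hy₂
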